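/- Let $d\in\{1,2,3\}$ and let $\Omega\subset\mathbb R^d$ be a bounded interval, polygonal or polyhedral domain (open, connected, $\Omega=\operatorname{int}\overline\Omega$). Let $a\in L^\infty(\Omega)^d$ be divergence-free in the sense of distributions, $\mu\in L^\infty(\Omega)$ with $\mu\ge\mu_0>0$ a.e., $f\in L^2(\Omega)$, and put $$a(w,v)=(a\cdot\nabla w,v)+(\mu\nabla w,\nabla v),\qquad w,v\in H^1_0(\Omega),$$ where $(\cdot,\cdot)$ is the inner product of $L^2(\Omega)$. Let $u\in H^1_0(\Omega)$ be the solution of $a(u,v)=(f,v)$ for all $v\in H^1_0(\Omega)$. Assume that 1. $u\in H^2(\Omega)$ (and let $u$ denote its representative that is continuous on $\overline\Omega$), and $\Delta u\neq0$ in $L^2(\Omega)$; 2. either $a$ is (a.e. equal to) a nonzero constant vector, or $a\cdot\nabla u\ne 0$ in $L^2(\Omega)$; 3. the adjoint problem is $H^2$-regularising: there is $C$ such that, whenever $g\in L^2(\Omega)$ and $\varphi\in H^1_0(\Omega)$ satisfies $a(v,\varphi)=(g,v)$ for all $v\in H^1_0(\Omega)$, one has $\varphi\in H^2(\Omega)$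 and $\|\varphi\|_{H^2(\Omega)}\le C\|g\|_{L^2(\Omega)}$. Let $\{\mathcal T_h\}$ be a family of conforming simplicial triangulations of $\overline\Omega$ that is regular in the sense of Ciarlet: there is $\sigma$ such that every simplex $K$ of every $\mathcal T_h$ contains a ball of diameter at least $\operatorname{diam}(K)/\sigma$. Here $h=\max_{K\in\mathcal T_h}\operatorname{diam}K$. Let $l\ge1$, let $V_h$ be the space of functions that are continuous on $\overline\Omega$ and polynomials of degree at most $l$ on each $K\in\mathcal T_h$, and let $X_h=V_h\cap H^1_0(\Omega)$. Let $\Pi_hu\in V_h$ be the Lagrange interpolate of $u$ of degree $l$. For $\tau>0$ let $u_h(\tau)\in X_h$ be the solution of the term-by-term stabilised method $$a(u_h,v_h)+\sum_{K\in\mathcal T_h}\tau\,(a\cdot\nabla u_h,a\cdot\nabla v_h)_{L^2(K)}=(f,v_h)\qquad\forall v_h\in X_h,$$ and let $J(\tau)=\frac12\|u_h(\tau)-\Pi_hu\|_{L^2(\Omega)}^2$. Then there is $\alpha_0>0$ such that for every $\alpha_{\max}>\alpha_0$ there is $h_0>0$ such that, for all $\alpha_{\min}\in[\alpha_0,\alpha_{\max})$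 and all triangulations of the family with $h<h_0$, the functional $J$ is strictly convex on $[\alpha_{\min}h^2,\alpha_{\max}h^2]$ and has exactly one minimiser in this interval. -/

import Mathlib

open MeasureTheory Set

noncomputable section

namespace AdvDiff

/-- Euclidean space `ℝ^d`. -/
abbrev Space (d : ℕ) := EuclideanSpace ℝ (Fin d)

/-! ### Sobolev spaces on an open set, through weak derivatives -/

/-- `φ ∈ C_c^∞(Ω)`. -/
def IsTestFunction {d : ℕ} (Ω : Set (Space d)) (φ : Space d → ℝ) : Prop :=
  ContDiff ℝ ((⊤ : ℕ∞) : WithTop ℕ∞) φ ∧ HasCompactSupport φ ∧ tsupport φ ⊆ Ω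

/-- The classical partial derivative `∂_i φ`. -/
def classicalPartial {d : ℕ} (i : Fin d) (φ : Space d → ℝ) (x : Space d) : ℝ :=
  fderiv ℝ φ x (EuclideanSpace.single i 1)

/-- `v ∈ L²(Ω)`. -/
def MemL2 {d : ℕ} (Ω : Set (Space d)) (v : Space d → ℝ) : Prop :=
  MemLp v 2 (volume.restrict Ω)

/-- `w` is a square-integrable weak partial derivative `∂_i v` in `Ω`. -/
def IsWeakPartial {d : ℕ} (Ω : Set (Space d)) (i : Fin d) (v w : Space d → ℝ) : Prop :=
  MemL2 Ω w ∧ ∀ φ, IsTestFunction Ω φ →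
    ∫ x in Ω, v x * classicalPartial i φ x = - ∫ x in Ω, w x * φ x

/-- `v ∈ H¹(Ω)`. -/
def MemH1 {d : ℕ} (Ω : Set (Space d)) (v : Space d → ℝ) : Prop :=
  MemL2 Ω v ∧ ∀ i, ∃ w, IsWeakPartial Ω i v w

open Classical in
/-- The weak partial derivative `∂_i v` of `v ∈ H¹(Ω)`, unique up to null sets of `Ω`. -/
def weakPartial {d : ℕ} (Ω : Set (Space d)) (i : Fin d) (v : Space d → ℝ) : Space d → ℝ :=
  if h : ∃ w, IsWeakPartial Ω i v w then h.choose else 0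

/-- The weak gradient `∇v` of `v ∈ H¹(Ω)`. -/
def weakGrad {d : ℕ} (Ω : Set (Space d)) (v : Space d → ℝ) (x : Space d) : Space d :=
  WithLp.toLp 2 fun i => weakPartial Ω i v x

/-- `v ∈ H¹₀(Ω)`, the closure of `C_c^∞(Ω)` in `H¹(Ω)`. -/
def MemH10 {d : ℕ} (Ω : Set (Space d)) (v : Space d → ℝ) : Prop :=
  MemH1 Ω v ∧ ∀ ε > 0, ∃ φ, IsTestFunction Ω φ ∧
    (∫ x in Ω, (v x - φ x) ^ 2) +
      ∑ i, ∫ x in Ω, (weakPartial Ω i v x - classicalPartial i φ x) ^ 2 < ε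

/-- `v ∈ H²(Ω)`. -/
def MemH2 {d : ℕ} (Ω : Set (Space d)) (v : Space d → ℝ) : Prop :=
  MemH1 Ω v ∧ ∀ i, MemH1 Ω (weakPartial Ω i v)

/-- The square of the `H²(Ω)` norm. -/
def normSqH2 {d : ℕ} (Ω : Set (Space d)) (v : Space d → ℝ) : ℝ :=
  (∫ x in Ω, v x ^ 2) + (∑ i, ∫ x in Ω, weakPartial Ω i v x ^ 2) +
    ∑ i, ∑ j, ∫ x in Ω, weakPartial Ω j (weakPartial Ω i v) x ^ 2

/-- The Laplacian `Δv` of `v ∈ H²(Ω)`. -/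
def weakLaplacian {d : ℕ} (Ω : Set (Space d)) (v : Space d → ℝ) (x : Space d) : ℝ :=
  ∑ i, weakPartial Ω i (weakPartial Ω i v) x

/-! ### The advection–diffusion problem -/

/-- `∇ · a = 0` in `Ω`, in the sense of distributions. -/
def IsDivFree {d : ℕ} (Ω : Set (Space d)) (a : Space d → Space d) : Prop :=
  ∀ φ, IsTestFunction Ω φ → ∫ x in Ω, ∑ i, a x i * classicalPartial i φ x = 0

/-- The advective derivative `a · ∇v`. -/
def advect {d : ℕ} (Ω : Set (Space d)) (a : Space d → Space d) (v : Space d → ℝ)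
    (x : Space d) : ℝ :=
  inner ℝ (a x) (weakGrad Ω v x)

/-- The bilinear form `a(u,v) = (a · ∇u, v) + (μ ∇u, ∇v)`. -/
def bilin {d : ℕ} (Ω : Set (Space d)) (a : Space d → Space d) (μ : Space d → ℝ)
    (u v : Space d → ℝ) : ℝ :=
  (∫ x in Ω, advect Ω a u x * v x) +
    ∫ x in Ω, μ x * inner ℝ (weakGrad Ω u x) (weakGrad Ω v x)

/-- `u ∈ H¹₀(Ω)` and `a(u,v) = (f,v)` for all `v ∈ H¹₀(Ω)`. -/
def IsWeakSolution {d : ℕ} (Ω : Set (Space d)) (a : Space d → Space d) (μ f u : Space d → ℝ) :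
    Prop :=
  MemH10 Ω u ∧ ∀ v, MemH10 Ω v → bilin Ω a μ u v = ∫ x in Ω, f x * v x

/-- `φ ∈ H¹₀(Ω)` and `a(v,φ) = (g,v)` for all `v ∈ H¹₀(Ω)`. -/
def IsAdjointSolution {d : ℕ} (Ω : Set (Space d)) (a : Space d → Space d)
    (μ g φ : Space d → ℝ) : Prop :=
  MemH10 Ω φ ∧ ∀ v, MemH10 Ω v → bilin Ω a μ v φ = ∫ x in Ω, g x * v x

/-- The adjoint problem is `H²`-regularising: for `g ∈ L²(Ω)` its solution `φ` lies in `H²(Ω)`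
and `‖φ‖_{H²} ≤ C ‖g‖_{L²}`. -/
def AdjointH2Regularising {d : ℕ} (Ω : Set (Space d)) (a : Space d → Space d)
    (μ : Space d → ℝ) : Prop :=
  ∃ C : ℝ, ∀ g φ, MemL2 Ω g → IsAdjointSolution Ω a μ g φ →
    MemH2 Ω φ ∧ normSqH2 Ω φ ≤ C ^ 2 * ∫ x in Ω, g x ^ 2

/-! ### Triangulations and Lagrange finite elements -/

/-- The closed simplex spanned by a finite set of vertices. -/
def simplex {d : ℕ} (K : Finset (Space d)) : Set (Space d) :=
  convexHull ℝ (K : Set (Space d))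

/-- A conforming triangulation of `closure Ω` by nondegenerate closed `d`-simplices, each given
by its set of vertices: two simplices meet exactly in the face spanned by their common vertices
(possibly empty). -/
structure Triangulation {d : ℕ} (Ω : Set (Space d)) where
  cells : Finset (Finset (Space d))
  card_cell : ∀ K ∈ cells, K.card = d + 1
  indep : ∀ K ∈ cells, AffineIndependent ℝ ((↑) : K → Space d)
  conforming : ∀ K ∈ cells, ∀ L ∈ cells,
    simplex K ∩ simplex L = convexHull ℝ ((K : Set (Space d)) ∩ (L : Set (Space d)))
  cover : ⋃ K ∈ cells, simplex K = closure Ω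

/-- The mesh size `h = max_K h_K`, where `h_K` is the diameter of `K`. -/
def Triangulation.meshSize {d : ℕ} {Ω : Set (Space d)} (T : Triangulation Ω) : ℝ :=
  ⨆ K : T.cells, Metric.diam (simplex (K : Finset (Space d)))

/-- Ciarlet's regularity with constant `σ`: each `K` contains a ball of some diameter `2 r`
with `h_K ≤ σ (2 r)`. -/
def Triangulation.IsShapeRegular {d : ℕ} {Ω : Set (Space d)} (T : Triangulation Ω) (σ : ℝ) :
    Prop :=
  ∀ K ∈ T.cells, ∃ (c : Space d) (r : ℝ), 0 < r ∧ Metric.closedBall c r ⊆ simplex K ∧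
    Metric.diam (simplex K) ≤ σ * (2 * r)

/-- The restriction of `v` to `S` is a polynomial of total degree at most `l`. -/
def IsPolyOn {d : ℕ} (l : ℕ) (S : Set (Space d)) (v : Space d → ℝ) : Prop :=
  ∃ p : MvPolynomial (Fin d) ℝ, p.totalDegree ≤ l ∧
    ∀ x ∈ S, v x = MvPolynomial.eval (fun i => x i) p

/-- `V_h^{(l)}`: continuous functions on `closure Ω` that are polynomials of degree at most `l`
on each cell. Such a function is represented by its extension by zero to the whole space. -/
def Triangulation.lagrangeSpace {d : ℕ} {Ω : Set (Space d)} (T : Triangulation Ω) (l : ℕ) :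
    Set (Space d → ℝ) :=
  {v | ContinuousOn v (closure Ω) ∧ (∀ K ∈ T.cells, IsPolyOn l (simplex K) v) ∧
    ∀ x, x ∉ closure Ω → v x = 0}

/-- `X_h = V_h^{(l)} ∩ H¹₀(Ω)`. -/
def Triangulation.discreteSpace {d : ℕ} {Ω : Set (Space d)} (T : Triangulation Ω) (l : ℕ) :
    Set (Space d → ℝ) :=
  {v | v ∈ T.lagrangeSpace l ∧ MemH10 Ω v}

/-- The Lagrange nodes of degree `l` of the simplex `K`: the points whose barycentric
coordinates are multiples of `1 / l`. -/
def lagrangeNodes {d : ℕ} (l : ℕ) (K : Finset (Space d)) : Set (Space d) :=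
  {x | ∃ m : Space d → ℕ, ∑ v ∈ K, m v = l ∧ x = ∑ v ∈ K, ((m v : ℝ) / (l : ℝ)) • v}

/-- `p ∈ V_h^{(l)}` takes the values of `u` at all Lagrange nodes. -/
def Triangulation.IsInterpolant {d : ℕ} {Ω : Set (Space d)} (T : Triangulation Ω) (l : ℕ)
    (u p : Space d → ℝ) : Prop :=
  p ∈ T.lagrangeSpace l ∧ ∀ K ∈ T.cells, ∀ x ∈ lagrangeNodes l K, p x = u x

open Classical in
/-- The Lagrange interpolate `Π_h u`. -/
def Triangulation.interpolate {d : ℕ} {Ω : Set (Space d)} (T : Triangulation Ω) (l : ℕ)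
    (u : Space d → ℝ) : Space d → ℝ :=
  if h : ∃ p, T.IsInterpolant l u p then h.choose else 0

/-! ### The term-by-term stabilised method -/

/-- The stabilisation form `s_h(α, β) = ∑_K τ_K (α, β)_K`. -/
def Triangulation.stab {d : ℕ} {Ω : Set (Space d)} (T : Triangulation Ω)
    (τ : Finset (Space d) → ℝ) (α β : Space d → ℝ) : ℝ :=
  ∑ K ∈ T.cells, τ K * ∫ x in simplex K, α x * β x

/-- `w ∈ X_h` and `a(w,v) + s_h(a · ∇w, a · ∇v) = (f,v)` for all `v ∈ X_h`. -/
def Triangulation.IsDiscreteSolution {d : ℕ} {Ω : Set (Space d)} (T : Triangulation Ω) (l : ℕ)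
    (a : Space d → Space d) (μ f : Space d → ℝ) (τ : Finset (Space d) → ℝ)
    (w : Space d → ℝ) : Prop :=
  w ∈ T.discreteSpace l ∧ ∀ v ∈ T.discreteSpace l,
    bilin Ω a μ w v + T.stab τ (advect Ω a w) (advect Ω a v) = ∫ x in Ω, f x * v x

open Classical in
/-- The discrete solution `u_h(τ)`, with `τ_K = τ` for all cells `K`. -/
def Triangulation.discreteSolution {d : ℕ} {Ω : Set (Space d)} (T : Triangulation Ω) (l : ℕ)
    (a : Space d → Space d) (μ f : Space d → ℝ) (τ : ℝ) : Space d → ℝ :=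
  if h : ∃ w, T.IsDiscreteSolution l a μ f (fun _ => τ) w then h.choose else 0

/-- The least-squares functional `J(τ) = ½ ‖u_h(τ) - Π_h u‖²` in the norm of `L²(Ω)`. -/
def Triangulation.lsFunctional {d : ℕ} {Ω : Set (Space d)} (T : Triangulation Ω) (l : ℕ)
    (a : Space d → Space d) (μ f u : Space d → ℝ) (τ : ℝ) : ℝ :=
  (1 / 2 : ℝ) * ∫ x in Ω, (T.discreteSolution l a μ f τ x - T.interpolate l u x) ^ 2

end AdvDiff

end

/-!
Let `w(τ)` be the discrete solution. It is the Galerkin solution for the form `a + τ s`, where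
`s(v, w) = (a · ∇v, a · ∇w)`, and differentiating its equation in `τ` shows that `w'` and `w''`
solve the same perturbed problem with data `-s(w, ·)` and `-2 s(w', ·)`. The second derivative of
`J = ½ ‖w - Π_h u‖²` is `(w - Π_h u, w'') + ‖w'‖²`. As `h → 0` and `τ → 0` jointly, Strang's lemma
gives `w → u` and `w' → z` in `H¹₀`, where `z` solves `a(z, ·) = -s(u, ·)`, while `w''` stays
bounded and `Π_h u → u` uniformly; hence `J'' → ‖z‖²`. This limit is positive because `s(u, ·) ≠ 0`,
so `J` is strictly convex on a fixed interval `[0, δ]` once `h` is small, and this interval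
eventually contains `[αmin h², αmax h²]`.

Strang's lemma needs the spaces `X_h` to be asymptotically dense. A test function is approximated
by its continuous piecewise affine interpolate, which vanishes outside `Ω` and is Lipschitz, hence
lies in `H¹₀`.
-/

noncomputable section

namespace AdvDiff

open Filter Topology

/-! ### Galerkin methods with a vanishing perturbation -/

section Galerkin

variable {H Y : Type*} [NormedAddCommGroup H] [InnerProductSpace ℝ H]
  [NormedAddCommGroup Y] [InnerProductSpace ℝ Y]

/-- `w` is the Galerkin solution in `X` of the variational problem with data `G` for the form
`B` perturbed by `τ S`. -/
def IsGalerkin (B S : H →L[ℝ] H →L[ℝ] ℝ) (X : Submodule ℝ H) (τ : ℝ) (G : H →L[ℝ] ℝ) (w : H) :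
    Prop :=
  w ∈ X ∧ ∀ v ∈ X, B w v + τ * S w v = G v

variable {B S : H →L[ℝ] H →L[ℝ] ℝ} {X : Submodule ℝ H} {c τ : ℝ} {G : H →L[ℝ] ℝ} {w : H}

theorem exists_eq_of_isCoercive [CompleteSpace H] (hB : IsCoercive B) (G : H →L[ℝ] ℝ) :
    ∃ z, B z = G := by
  refine ⟨hB.continuousLinearEquivOfBilin.symm ((InnerProductSpace.toDual ℝ H).symm G), ?_⟩
  ext v
  rw [← hB.continuousLinearEquivOfBilin_apply, ContinuousLinearEquiv.apply_symm_apply,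
    InnerProductSpace.toDual_symm_apply]

theorem exists_isGalerkin [CompleteSpace X] (hB : IsCoercive B) (hS : ∀ v, 0 ≤ S v v)
    (hτ : 0 ≤ τ) (G : H →L[ℝ] ℝ) : ∃ w, IsGalerkin B S X τ G w := by
  obtain ⟨c, hc, hcB⟩ := hB
  have hcoercive : IsCoercive ((B + τ • S).bilinearComp X.subtypeL X.subtypeL) :=
    ⟨c, hc, fun v => (hcB v).trans (le_add_of_nonneg_right (mul_nonneg hτ (hS v)))⟩
  obtain ⟨w, hw⟩ := exists_eq_of_isCoercive hcoercive (G.comp X.subtypeL)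
  exact ⟨w, w.2, fun v hv => DFunLike.congr_fun hw ⟨v, hv⟩⟩

theorem IsGalerkin.norm_le (hw : IsGalerkin B S X τ G w) (hc : 0 < c)
    (hB : ∀ v, c * ‖v‖ * ‖v‖ ≤ B v v) (hS : ∀ v, 0 ≤ S v v) (hτ : 0 ≤ τ) :
    ‖w‖ ≤ c⁻¹ * ‖G‖ := by
  rcases (norm_nonneg w).eq_or_lt with hw0 | hw0
  · rw [← hw0]
    positivity
  · rw [inv_mul_eq_div, le_div_iff₀' hc]
    refine le_of_mul_le_mul_right ?_ hw0
    calc c * ‖w‖ * ‖w‖ ≤ B w w + τ * S w w :=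
          (hB w).trans (le_add_of_nonneg_right (mul_nonneg hτ (hS w)))
      _ = G w := hw.2 w hw.1
      _ ≤ ‖G‖ * ‖w‖ := (le_abs_self _).trans (G.le_opNorm w)

/-- Strang's lemma: the error splits into the error in the data, the perturbation, and the best
approximation. -/
theorem IsGalerkin.norm_sub_le (hw : IsGalerkin B S X τ G w) (hc : 0 < c)
    (hB : ∀ v, c * ‖v‖ * ‖v‖ ≤ B v v) (hS : ∀ v, 0 ≤ S v v) (hτ : 0 ≤ τ) (z : H) :
    ‖w - z‖ ≤ c⁻¹ * ‖G - B z - τ • S z‖ +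
      (1 + c⁻¹ * (‖B‖ + τ * ‖S‖)) * Metric.infDist z (X : Set H) := by
  suffices h : ∀ y ∈ X,
      ‖w - z‖ ≤ c⁻¹ * ‖G - B z - τ • S z‖ + (1 + c⁻¹ * (‖B‖ + τ * ‖S‖)) * dist z y by
    have hpos : 0 < 1 + c⁻¹ * (‖B‖ + τ * ‖S‖) := by positivity
    rw [← sub_le_iff_le_add', ← div_le_iff₀' hpos, Metric.le_infDist ⟨0, X.zero_mem⟩]
    intro y hy
    rw [div_le_iff₀' hpos, sub_le_iff_le_add']
    exact h y hy
  intro y hy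
  have herr : IsGalerkin B S X τ (G - B z - τ • S z + (B (z - y) + τ • S (z - y))) (w - y) := by
    refine ⟨X.sub_mem hw.1 hy, fun v hv => ?_⟩
    have hwv := hw.2 v hv
    simp only [map_sub, _root_.add_apply, _root_.sub_apply, _root_.smul_apply,
      smul_eq_mul]
    linarith
  have hdata : ‖G - B z - τ • S z + (B (z - y) + τ • S (z - y))‖ ≤
      ‖G - B z - τ • S z‖ + (‖B‖ * ‖z - y‖ + τ * (‖S‖ * ‖z - y‖)) := by
    refine (norm_add_le _ _).trans (add_le_add_right ((norm_add_le _ _).trans ?_) _)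
    rw [norm_smul, Real.norm_of_nonneg hτ]
    gcongr
    exacts [B.le_opNorm _, S.le_opNorm _]
  calc ‖w - z‖ ≤ ‖w - y‖ + ‖y - z‖ := norm_sub_le_norm_sub_add_norm_sub _ _ _
    _ ≤ c⁻¹ * (‖G - B z - τ • S z‖ + (‖B‖ * ‖z - y‖ + τ * (‖S‖ * ‖z - y‖))) + ‖z - y‖ := by
        rw [norm_sub_rev y z]
        gcongr
        exact (herr.norm_le hc hB hS hτ).trans (by gcongr)
    _ = c⁻¹ * ‖G - B z - τ • S z‖ + (1 + c⁻¹ * (‖B‖ + τ * ‖S‖)) * dist z y := by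
        rw [dist_eq_norm]
        ring

theorem IsGalerkin.tendsto {κ : Type*} {F : Filter κ} {X : κ → Submodule ℝ H} {τ : κ → ℝ}
    {G : κ → H →L[ℝ] ℝ} {w : κ → H} {z : H} (hB : IsCoercive B) (hS : ∀ v, 0 ≤ S v v)
    (hX : Tendsto (fun k => Metric.infDist z (X k : Set H)) F (𝓝 0)) (hτ : Tendsto τ F (𝓝[≥] 0))
    (hG : Tendsto G F (𝓝 (B z))) (hw : ∀ᶠ k in F, IsGalerkin B S (X k) (τ k) (G k) (w k)) :
    Tendsto w F (𝓝 z) := by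
  obtain ⟨c, hc, hcB⟩ := hB
  obtain ⟨hτ0, hτnonneg⟩ := tendsto_nhdsWithin_iff.mp hτ
  have hdata : Tendsto (fun k => G k - B z - τ k • S z) F (𝓝 0) := by
    simpa using (hG.sub_const (B z)).sub (hτ0.smul_const (S z))
  have hbound := (hdata.norm.const_mul c⁻¹).add
    (((((hτ0.mul_const ‖S‖).const_add ‖B‖).const_mul c⁻¹).const_add 1).mul hX)
  rw [norm_zero, mul_zero, mul_zero, add_zero] at hbound
  rw [tendsto_iff_norm_sub_tendsto_zero]
  refine squeeze_zero' (Eventually.of_forall fun _ => norm_nonneg _) ?_ hbound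
  filter_upwards [hw, hτnonneg] with k hwk hτk
  exact hwk.norm_sub_le hc hcB hS hτk z

theorem IsGalerkin.hasDerivWithinAt (hB : IsCoercive B) (hS : ∀ v, 0 ≤ S v v) {I : Set ℝ}
    (hI : I ⊆ Ici 0) {q : ℝ → H} {q' : H} {G : ℝ → H →L[ℝ] ℝ} {G' : H →L[ℝ] ℝ}
    (hq : ∀ t ∈ I, IsGalerkin B S X t (G t) (q t)) (hτ : τ ∈ I)
    (hG : HasDerivWithinAt G G' I τ) (hq' : IsGalerkin B S X τ (G' - S (q τ)) q') :
    HasDerivWithinAt q q' I τ := by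
  obtain ⟨c, hc, hcB⟩ := hB
  rw [hasDerivWithinAt_iff_isLittleO] at hG ⊢
  have hremainder : ∀ t ∈ I, ‖q t - q τ - (t - τ) • q'‖ ≤
      c⁻¹ * ‖(G t - G τ - (t - τ) • G') - (t - τ) ^ 2 • S q'‖ := by
    intro t ht
    refine IsGalerkin.norm_le (B := B) (S := S) (X := X) (τ := t)
      ⟨X.sub_mem (X.sub_mem (hq t ht).1 (hq τ hτ).1) (X.smul_mem _ hq'.1), fun v hv => ?_⟩
      hc hcB hS (hI ht)
    have ht' := (hq t ht).2 v hv
    have hτ' := (hq τ hτ).2 v hv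
    have hv' := hq'.2 v hv
    simp only [map_sub, map_smul, _root_.sub_apply, _root_.smul_apply, smul_eq_mul] at hv' ⊢
    linear_combination ht' - hτ' - (t - τ) * hv'
  have hsq : (fun t => (t - τ) ^ 2 • S q') =o[𝓝[I] τ] fun t => t - τ := by
    have hbigO : (fun t : ℝ => (t - τ) ^ 2 • S q') =O[𝓝[I] τ] fun t => (t - τ) ^ 2 :=
      Asymptotics.IsBigO.of_bound ‖S q'‖ (Eventually.of_forall fun t => by
        rw [norm_smul, mul_comm])
    have hlittleO : (fun t : ℝ => (t - τ) ^ 2) =o[𝓝 τ] fun t => t - τ := by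
      simpa using Asymptotics.isLittleO_pow_sub_sub τ (m := 2) (by norm_num)
    exact hbigO.trans_isLittleO (hlittleO.mono nhdsWithin_le_nhds)
  exact (Asymptotics.IsBigO.of_bound c⁻¹
    (eventually_of_mem self_mem_nhdsWithin hremainder)).trans_isLittleO (hG.sub hsq)

theorem hasDerivWithinAt_half_norm_sub_sq {q : ℝ → Y} {q' p : Y} {s : Set ℝ} {t : ℝ}
    (hq : HasDerivWithinAt q q' s t) :
    HasDerivWithinAt (fun t => (1 / 2 : ℝ) * ‖q t - p‖ ^ 2) (inner ℝ (q t - p) q') s t :=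
  ((hq.sub_const p).norm_sq.const_mul (1 / 2 : ℝ)).congr_deriv (by ring)

theorem strictConvexOn_half_norm_sub_sq {q q' q'' : ℝ → Y} {p : Y} {s : Set ℝ} (hs : Convex ℝ s)
    (hq : ∀ t ∈ s, HasDerivWithinAt q (q' t) s t)
    (hq' : ∀ t ∈ s, HasDerivWithinAt q' (q'' t) s t)
    (hpos : ∀ t ∈ s, 0 < inner ℝ (q t - p) (q'' t) + ‖q' t‖ ^ 2) :
    StrictConvexOn ℝ s fun t => (1 / 2 : ℝ) * ‖q t - p‖ ^ 2 := by
  have hJ' := fun t ht => hasDerivWithinAt_half_norm_sub_sq (p := p) (hq t ht)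
  have hJ'' : ∀ t ∈ s, HasDerivWithinAt (fun t => inner ℝ (q t - p) (q' t))
      (inner ℝ (q t - p) (q'' t) + ‖q' t‖ ^ 2) s t := fun t ht =>
    (((hq t ht).sub_const p).inner ℝ (hq' t ht)).congr_deriv
      (by rw [real_inner_self_eq_norm_sq])
  refine strictConvexOn_of_deriv2_pos hs (fun t ht => (hJ' t ht).continuousWithinAt)
    fun t ht => ?_
  have hderiv : deriv (fun t => (1 / 2 : ℝ) * ‖q t - p‖ ^ 2) =ᶠ[𝓝 t]
      fun t => inner ℝ (q t - p) (q' t) := by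
    filter_upwards [isOpen_interior.mem_nhds ht] with r hr
    exact ((hJ' r (interior_subset hr)).hasDerivAt (mem_interior_iff_mem_nhds.mp hr)).deriv
  rw [Function.iterate_succ, Function.iterate_one, Function.comp_apply, hderiv.deriv_eq,
    ((hJ'' t (interior_subset ht)).hasDerivAt (mem_interior_iff_mem_nhds.mp ht)).deriv]
  exact hpos t (interior_subset ht)

/-- As the mesh is refined and `τ → 0`, the Galerkin solutions `w`, `w'`, `w''` tend to `u`, to
the solution `z` of `B z = -S u` and to that of `B z' = -2 S z`, so the second derivative of
`½ ‖j w - p‖²` tends to `‖j z‖²`. -/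
theorem eventually_inner_add_norm_sq_pos_of_isGalerkin [CompleteSpace H] (hB : IsCoercive B)
    (hS : ∀ v, 0 ≤ S v v) (j : H →L[ℝ] Y) (hj : Function.Injective j) {u : H} (hu : S u ≠ 0)
    {ι : Type*} {F : Filter ι} {X : ι → Submodule ℝ H}
    (hX : ∀ v, Tendsto (fun i => Metric.infDist v (X i : Set H)) F (𝓝 0)) {p : ι → Y}
    (hp : Tendsto p F (𝓝 (j u))) {w w' w'' : ι → ℝ → H}
    (hw : ∀ i, ∀ τ ∈ Ici 0, IsGalerkin B S (X i) τ (B u) (w i τ))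
    (hw' : ∀ i, ∀ τ ∈ Ici 0, IsGalerkin B S (X i) τ (-S (w i τ)) (w' i τ))
    (hw'' : ∀ i, ∀ τ ∈ Ici 0, IsGalerkin B S (X i) τ (-S (w' i τ) - S (w' i τ)) (w'' i τ)) :
    ∀ᶠ k : ι × ℝ in F ×ˢ 𝓝[≥] 0,
      0 < inner ℝ (j (w k.1 k.2) - p k.1) (j (w'' k.1 k.2)) + ‖j (w' k.1 k.2)‖ ^ 2 := by
  obtain ⟨z, hz⟩ := exists_eq_of_isCoercive hB (-S u)
  obtain ⟨z', hz'⟩ := exists_eq_of_isCoercive hB (-S z - S z)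
  have hjz : j z ≠ 0 := fun h0 => hu <| by
    rw [(map_eq_zero_iff j hj).mp h0, map_zero] at hz
    exact neg_eq_zero.mp hz.symm
  have hnonneg : ∀ᶠ k : ι × ℝ in F ×ˢ 𝓝[≥] 0, k.2 ∈ Ici 0 :=
    tendsto_snd.eventually self_mem_nhdsWithin
  have hlim : Tendsto (fun k : ι × ℝ => w k.1 k.2) (F ×ˢ 𝓝[≥] 0) (𝓝 u) :=
    IsGalerkin.tendsto hB hS ((hX u).comp tendsto_fst) tendsto_snd tendsto_const_nhds
      (hnonneg.mono fun k hk => hw k.1 k.2 hk)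
  have hlim' : Tendsto (fun k : ι × ℝ => w' k.1 k.2) (F ×ˢ 𝓝[≥] 0) (𝓝 z) :=
    IsGalerkin.tendsto hB hS ((hX z).comp tendsto_fst) tendsto_snd
      (hz ▸ ((S.continuous.tendsto u).comp hlim).neg)
      (hnonneg.mono fun k hk => hw' k.1 k.2 hk)
  have hlim'' : Tendsto (fun k : ι × ℝ => w'' k.1 k.2) (F ×ˢ 𝓝[≥] 0) (𝓝 z') :=
    IsGalerkin.tendsto hB hS ((hX z').comp tendsto_fst) tendsto_snd
      (hz' ▸ ((S.continuous.tendsto z).comp hlim').neg.sub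
        ((S.continuous.tendsto z).comp hlim'))
      (hnonneg.mono fun k hk => hw'' k.1 k.2 hk)
  have hsecond := ((((j.continuous.tendsto u).comp hlim).sub (hp.comp tendsto_fst)).inner
    ((j.continuous.tendsto z').comp hlim'')).add (((j.continuous.tendsto z).comp hlim').norm.pow 2)
  rw [sub_self, inner_zero_left, zero_add] at hsecond
  exact hsecond.eventually_const_lt (by positivity)

theorem exists_strictConvexOn_of_isGalerkin [CompleteSpace H] (hB : IsCoercive B)
    (hS : ∀ v, 0 ≤ S v v) (j : H →L[ℝ] Y) (hj : Function.Injective j) {u : H} (hu : S u ≠ 0)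
    {ι : Type*} {F : Filter ι} {X : ι → Submodule ℝ H} [∀ i, CompleteSpace (X i)]
    (hX : ∀ v, Tendsto (fun i => Metric.infDist v (X i : Set H)) F (𝓝 0)) {p : ι → Y}
    (hp : Tendsto p F (𝓝 (j u))) {w : ι → ℝ → H}
    (hw : ∀ i, ∀ τ ∈ Ici 0, IsGalerkin B S (X i) τ (B u) (w i τ)) :
    ∃ δ > 0, ∀ᶠ i in F,
      ContinuousOn (fun τ => (1 / 2 : ℝ) * ‖j (w i τ) - p i‖ ^ 2) (Icc 0 δ) ∧
      StrictConvexOn ℝ (Icc 0 δ) fun τ => (1 / 2 : ℝ) * ‖j (w i τ) - p i‖ ^ 2 := by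
  choose! w' hw' using fun i τ (hτ : τ ∈ Ici (0 : ℝ)) =>
    exists_isGalerkin (X := X i) hB hS hτ (-S (w i τ))
  choose! w'' hw'' using fun i τ (hτ : τ ∈ Ici (0 : ℝ)) =>
    exists_isGalerkin (X := X i) hB hS hτ (-S (w' i τ) - S (w' i τ))
  have hderiv : ∀ i, ∀ τ ∈ Ici 0, HasDerivWithinAt (w i) (w' i τ) (Ici 0) τ := fun i τ hτ =>
    IsGalerkin.hasDerivWithinAt hB hS subset_rfl (hw i) hτ (hasDerivWithinAt_const _ _ _)
      (by simpa using hw' i τ hτ)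
  have hderiv' : ∀ i, ∀ τ ∈ Ici 0, HasDerivWithinAt (w' i) (w'' i τ) (Ici 0) τ := fun i τ hτ =>
    IsGalerkin.hasDerivWithinAt hB hS subset_rfl (hw' i) hτ
      (S.hasFDerivAt.comp_hasDerivWithinAt τ (hderiv i τ hτ)).neg (hw'' i τ hτ)
  obtain ⟨P, hP, Q, hQ, hPQ⟩ := eventually_prod_iff.mp
    (eventually_inner_add_norm_sq_pos_of_isGalerkin hB hS j hj hu hX hp hw hw' hw'')
  obtain ⟨δ, hδ, hδQ⟩ := mem_nhdsGE_iff_exists_Icc_subset.mp hQ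
  refine ⟨δ, hδ, hP.mono fun i hi => ?_⟩
  have hj_deriv : ∀ τ ∈ Icc 0 δ, HasDerivWithinAt (fun τ => j (w i τ)) (j (w' i τ)) (Icc 0 δ) τ :=
    fun τ hτ => (j.hasFDerivAt.comp_hasDerivWithinAt τ (hderiv i τ hτ.1)).mono Icc_subset_Ici_self
  have hj_deriv' : ∀ τ ∈ Icc 0 δ,
      HasDerivWithinAt (fun τ => j (w' i τ)) (j (w'' i τ)) (Icc 0 δ) τ := fun τ hτ =>
    (j.hasFDerivAt.comp_hasDerivWithinAt τ (hderiv' i τ hτ.1)).mono Icc_subset_Ici_self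
  exact ⟨fun τ hτ => (hasDerivWithinAt_half_norm_sub_sq (hj_deriv τ hτ)).continuousWithinAt,
    strictConvexOn_half_norm_sub_sq (convex_Icc 0 δ) hj_deriv hj_deriv'
      fun τ hτ => hPQ hi (hδQ hτ)⟩

end Galerkin

/-! ### Lipschitz functions on a finite closed cover -/

theorem exists_frequently_mem_of_iUnion_eq_univ {α κ : Type*} [Finite κ] {C : κ → Set α}
    (hC : ⋃ k, C k = univ) (F : Filter α) [F.NeBot] : ∃ k, ∃ᶠ x in F, x ∈ C k := by
  by_contra! hno
  obtain ⟨x, hx⟩ := (eventually_all.mpr hno).exists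
  obtain ⟨k, hk⟩ := mem_iUnion.mp (hC.ge (mem_univ x))
  exact hx k hk

theorem norm_sub_le_of_frequently_norm_sub_le {E : Type*} [NormedAddCommGroup E] {g : ℝ → E}
    {a b M : ℝ} (hab : a ≤ b) (hg : ContinuousOn g (Icc a b))
    (hM : ∀ t ∈ Ico a b, ∃ᶠ z in 𝓝[>] t, ‖g z - g t‖ ≤ M * (z - t)) :
    ‖g b - g a‖ ≤ M * (b - a) := by
  suffices h : ∀ ε > 0, ‖g b - g a‖ ≤ (M + ε) * (b - a) by
    have hcont : Continuous fun ε => (M + ε) * (b - a) := by fun_prop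
    have hlim := (hcont.tendsto 0).mono_left (nhdsWithin_le_nhds (s := Ioi 0))
    rw [add_zero] at hlim
    exact ge_of_tendsto hlim (eventually_of_mem self_mem_nhdsWithin h)
  intro ε hε
  refine image_norm_le_of_liminf_right_slope_norm_lt_deriv_boundary (f := fun t => g t - g a)
    (f' := fun _ => M) (B := fun t => (M + ε) * (t - a)) (B' := fun _ => M + ε)
    (hg.sub continuousOn_const) (fun t ht r hr => ?_) (by simp) (by fun_prop)
    (fun t _ => by
      simpa using (((hasDerivAt_id t).sub_const a).const_mul (M + ε)).hasDerivWithinAt)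
    (fun _ _ _ => lt_add_of_pos_right M hε) (right_mem_Icc.mpr hab)
  refine ((hM t ht).and_eventually self_mem_nhdsWithin).mono fun z hz => ?_
  have hzt : 0 < z - t := sub_pos.mpr hz.2
  rw [slope_def_field, div_lt_iff₀ hzt]
  calc ‖g z - g a‖ - ‖g t - g a‖ ≤ ‖(g z - g a) - (g t - g a)‖ := norm_sub_norm_le _ _
    _ = ‖g z - g t‖ := by rw [sub_sub_sub_cancel_right]
    _ ≤ M * (z - t) := hz.1
    _ < r * (z - t) := by gcongr

theorem lipschitzWith_of_finite_closed_cover {E E' κ : Type*} [NormedAddCommGroup E]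
    [NormedSpace ℝ E] [NormedAddCommGroup E'] [Finite κ] {C : κ → Set E}
    (hC : ∀ k, IsClosed (C k)) (hcov : ⋃ k, C k = univ) {L : NNReal} {f : E → E'}
    (hf : ∀ k, LipschitzOnWith L f (C k)) : LipschitzWith L f := by
  have hcont : Continuous f :=
    (locallyFinite_of_finite C).continuous hcov hC fun k => (hf k).continuousOn
  refine LipschitzWith.of_dist_le_mul fun y x => ?_
  have hline : Continuous (AffineMap.lineMap x y : ℝ → E) := AffineMap.lineMap_continuous
  have hbound : ∀ t ∈ Ico (0 : ℝ) 1, ∃ᶠ z in 𝓝[>] t,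
      ‖f (AffineMap.lineMap x y z) - f (AffineMap.lineMap x y t)‖ ≤ L * dist y x * (z - t) := by
    intro t _
    obtain ⟨k, hk⟩ := exists_frequently_mem_of_iUnion_eq_univ
      (C := fun k => AffineMap.lineMap x y ⁻¹' C k)
      (by rw [← preimage_iUnion, hcov, preimage_univ]) (𝓝[>] t)
    have htk : AffineMap.lineMap x y t ∈ C k :=
      ((hC k).preimage hline).mem_of_frequently_of_tendsto hk
        (tendsto_id.mono_left nhdsWithin_le_nhds)
    refine (hk.and_eventually self_mem_nhdsWithin).mono fun z hz => ?_
    have hLip := (hf k).dist_le_mul _ hz.1 _ htk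
    rwa [dist_lineMap_lineMap, Real.dist_eq, abs_of_pos (sub_pos.mpr hz.2), dist_eq_norm,
      dist_comm x y, mul_comm (z - t), ← mul_assoc] at hLip
  have h01 := norm_sub_le_of_frequently_norm_sub_le zero_le_one
    (hcont.comp hline).continuousOn hbound
  simpa [dist_eq_norm] using h01

/-! ### Multiplication operators between `L²` spaces -/

section Lp

variable {α E : Type*} [MeasurableSpace α] {ν : Measure α} [NormedAddCommGroup E]
  [InnerProductSpace ℝ E]

theorem inner_Lp_eq_integral {f g : Lp E 2 ν} {v w : α → E} (hf : f =ᵐ[ν] v) (hg : g =ᵐ[ν] w) :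
    inner ℝ f g = ∫ x, inner ℝ (v x) (w x) ∂ν := by
  rw [L2.inner_def]
  refine integral_congr_ae ?_
  filter_upwards [hf, hg] with x hfx hgx
  rw [hfx, hgx]

theorem inner_Lp_real_eq_integral {f g : Lp ℝ 2 ν} {v w : α → ℝ} (hf : f =ᵐ[ν] v)
    (hg : g =ᵐ[ν] w) : inner ℝ f g = ∫ x, v x * w x ∂ν := by
  simp only [inner_Lp_eq_integral hf hg, RCLike.inner_apply, conj_trivial, mul_comm]

theorem norm_sq_Lp_eq_integral {f : Lp E 2 ν} {v : α → E} (hf : f =ᵐ[ν] v) :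
    ‖f‖ ^ 2 = ∫ x, ‖v x‖ ^ 2 ∂ν := by
  simp only [← real_inner_self_eq_norm_sq, inner_Lp_eq_integral hf hf]

theorem norm_sq_Lp_real_eq_integral {f : Lp ℝ 2 ν} {v : α → ℝ} (hf : f =ᵐ[ν] v) :
    ‖f‖ ^ 2 = ∫ x, v x ^ 2 ∂ν := by
  simp only [norm_sq_Lp_eq_integral hf, Real.norm_eq_abs, sq_abs]

/-- The pointwise inner product `g ↦ ⟪a, g⟫` with an essentially bounded field `a`, as an operator
from `L²` vector fields to `L²` functions. -/
def innerLp {a : α → E} (ha : MemLp a ⊤ ν) : Lp E 2 ν →L[ℝ] Lp ℝ 2 ν :=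
  (innerSL ℝ).holderL ν ⊤ 2 2 (ha.toLp a)

theorem innerLp_ae_eq {a : α → E} (ha : MemLp a ⊤ ν) {f : Lp E 2 ν} {g : α → E}
    (hf : f =ᵐ[ν] g) : innerLp ha f =ᵐ[ν] fun x => inner ℝ (a x) (g x) := by
  filter_upwards [(innerSL ℝ).coeFn_holder (r := 2) (ha.toLp a) f, ha.coeFn_toLp, hf]
    with x hx hax hfx
  rw [hax, hfx] at hx
  exact hx

theorem norm_innerLp_le {a : α → E} (ha : MemLp a ⊤ ν) {C : ℝ} (hC : ∀ᵐ x ∂ν, ‖a x‖ ≤ C)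
    (f : Lp E 2 ν) : ‖innerLp ha f‖ ≤ C * ‖f‖ := by
  refine Lp.norm_le_mul_norm_of_ae_le_mul ?_
  filter_upwards [innerLp_ae_eq ha (ae_eq_refl f), hC] with x hx hCx
  rw [hx]
  exact (norm_inner_le_norm _ _).trans (by gcongr)

/-- Multiplication by an essentially bounded function, as an operator on `L²` vector fields. -/
def smulLp {m : α → ℝ} (hm : MemLp m ⊤ ν) : Lp E 2 ν →L[ℝ] Lp E 2 ν :=
  (ContinuousLinearMap.lsmul ℝ ℝ).holderL ν ⊤ 2 2 (hm.toLp m)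

theorem smulLp_ae_eq {m : α → ℝ} (hm : MemLp m ⊤ ν) {f : Lp E 2 ν} {g : α → E}
    (hf : f =ᵐ[ν] g) : smulLp hm f =ᵐ[ν] fun x => m x • g x := by
  filter_upwards [(ContinuousLinearMap.lsmul ℝ ℝ).coeFn_holder (r := 2) (hm.toLp m) f,
    hm.coeFn_toLp, hf] with x hx hmx hfx
  rw [hmx, hfx] at hx
  exact hx

theorem mul_norm_sq_le_inner_smulLp {m : α → ℝ} (hm : MemLp m ⊤ ν) {m₀ : ℝ}
    (hm₀ : ∀ᵐ x ∂ν, m₀ ≤ m x) (f : Lp E 2 ν) : m₀ * ‖f‖ ^ 2 ≤ inner ℝ (smulLp hm f) f := by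
  rw [← real_inner_self_eq_norm_sq, L2.inner_def, L2.inner_def, ← integral_const_mul]
  refine integral_mono_ae ((L2.integrable_inner (𝕜 := ℝ) f f).const_mul _)
    (L2.integrable_inner (𝕜 := ℝ) _ f) ?_
  filter_upwards [smulLp_ae_eq hm (ae_eq_refl f), hm₀] with x hx hm₀x
  simp only [hx, inner_smul_left, conj_trivial]
  exact mul_le_mul_of_nonneg_right hm₀x real_inner_self_nonneg

end Lp

/-! ### A directional Poincaré inequality -/

theorem fderiv_sq_apply {E : Type*} [NormedAddCommGroup E] [NormedSpace ℝ E] {φ : E → ℝ}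
    {x : E} (hφ : DifferentiableAt ℝ φ x) (c : E) :
    fderiv ℝ (fun y => φ y ^ 2) x c = 2 * φ x * fderiv ℝ φ x c := by
  simp [fderiv_fun_pow 2 hφ]

theorem neg_inner_mul_le {E : Type*} [NormedAddCommGroup E] [InnerProductSpace ℝ E] {x : E} {R : ℝ}
    (hx : ‖x‖ ≤ R) (c : E) (s t : ℝ) :
    -(inner ℝ c x * (2 * s * t)) ≤ ‖c‖ ^ 2 / 2 * s ^ 2 + 2 * R ^ 2 * t ^ 2 := by
  have hs : |(inner ℝ c x : ℝ)| ≤ ‖c‖ * R :=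
    (abs_real_inner_le_norm c x).trans (by gcongr)
  calc -(inner ℝ c x * (2 * s * t)) ≤ |inner ℝ c x * (2 * s * t)| := neg_le_abs _
    _ = |(inner ℝ c x : ℝ)| * (2 * |s| * |t|) := by simp [abs_mul]
    _ ≤ ‖c‖ * R * (2 * |s| * |t|) := by gcongr
    _ ≤ ‖c‖ ^ 2 / 2 * |s| ^ 2 + 2 * R ^ 2 * |t| ^ 2 := by
      linarith [sq_nonneg (‖c‖ * |s| - 2 * R * |t|)]
    _ = ‖c‖ ^ 2 / 2 * s ^ 2 + 2 * R ^ 2 * t ^ 2 := by rw [sq_abs, sq_abs]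

section Poincare

variable {E : Type*} [NormedAddCommGroup E] [InnerProductSpace ℝ E] [FiniteDimensional ℝ E]
  [MeasurableSpace E] [BorelSpace E] {ν : Measure E} [ν.IsAddHaarMeasure] {φ : E → ℝ}

theorem norm_sq_mul_integral_sq_eq (hφ : ContDiff ℝ 1 φ) (hφc : HasCompactSupport φ) (c : E) :
    ‖c‖ ^ 2 * ∫ x, φ x ^ 2 ∂ν = -∫ x, inner ℝ c x * (2 * φ x * fderiv ℝ φ x c) ∂ν := by
  have hdiff := hφ.differentiable one_ne_zero
  have hsq : Continuous fun x => φ x ^ 2 := hφ.continuous.pow 2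
  have hsqc : HasCompactSupport fun x => φ x ^ 2 := hφc.comp_left (g := (· ^ 2)) (by simp)
  have hd : Continuous fun x => fderiv ℝ (fun y => φ y ^ 2) x c :=
    ((hφ.pow 2).continuous_fderiv one_ne_zero).clm_apply continuous_const
  have h := integral_mul_fderiv_eq_neg_fderiv_mul_of_integrable (μ := ν) (f := innerSL ℝ c)
    (g := fun x => φ x ^ 2) (v := c) ?_ ?_ ?_ (fun x _ => (innerSL ℝ c).differentiableAt)
    (fun x _ => (hdiff x).pow 2)
  · simp only [fderiv_sq_apply (hdiff _), ContinuousLinearMap.fderiv, innerSL_apply_apply,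
      real_inner_self_eq_norm_sq, integral_const_mul] at h
    linarith
  · simp only [ContinuousLinearMap.fderiv]
    exact (hsq.integrable_of_hasCompactSupport hsqc).const_mul _
  · exact ((innerSL ℝ c).continuous.mul hd).integrable_of_hasCompactSupport
      (hsqc.fderiv_apply (𝕜 := ℝ) c).mul_left
  · exact ((innerSL ℝ c).continuous.mul hsq).integrable_of_hasCompactSupport hsqc.mul_left

theorem norm_sq_mul_integral_sq_le (hφ : ContDiff ℝ 1 φ) (hφc : HasCompactSupport φ) {R : ℝ}
    (hR : ∀ x, φ x ≠ 0 → ‖x‖ ≤ R) (c : E) :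
    ‖c‖ ^ 2 * ∫ x, φ x ^ 2 ∂ν ≤ 4 * R ^ 2 * ∫ x, fderiv ℝ φ x c ^ 2 ∂ν := by
  have hD : Continuous fun x => fderiv ℝ φ x c :=
    (hφ.continuous_fderiv one_ne_zero).clm_apply continuous_const
  have hDc : HasCompactSupport fun x => fderiv ℝ φ x c := hφc.fderiv_apply (𝕜 := ℝ) c
  have hiφ : Integrable (fun x => ‖c‖ ^ 2 / 2 * φ x ^ 2) ν :=
    (hφ.continuous.memLp_of_hasCompactSupport hφc).integrable_sq.const_mul _
  have hiD : Integrable (fun x => 2 * R ^ 2 * fderiv ℝ φ x c ^ 2) ν :=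
    (hD.memLp_of_hasCompactSupport hDc).integrable_sq.const_mul _
  have hi : Integrable (fun x => -((inner ℝ c x : ℝ) * (2 * φ x * fderiv ℝ φ x c))) ν := by
    refine (Continuous.integrable_of_hasCompactSupport (f := fun x => inner ℝ c x *
      (2 * φ x * fderiv ℝ φ x c)) (by fun_prop) ?_).neg
    exact (hDc.mul_left (f := fun x => 2 * φ x)).mul_left
  have young : ∀ x, -((inner ℝ c x : ℝ) * (2 * φ x * fderiv ℝ φ x c)) ≤
      ‖c‖ ^ 2 / 2 * φ x ^ 2 + 2 * R ^ 2 * fderiv ℝ φ x c ^ 2 := by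
    intro x
    rcases eq_or_ne (φ x) 0 with h0 | h0
    · rw [h0]
      have : 0 ≤ 2 * R ^ 2 * fderiv ℝ φ x c ^ 2 := by positivity
      linarith
    · exact neg_inner_mul_le (hR x h0) c _ _
  have hle : ‖c‖ ^ 2 * ∫ x, φ x ^ 2 ∂ν ≤ ‖c‖ ^ 2 / 2 * ∫ x, φ x ^ 2 ∂ν +
      2 * R ^ 2 * ∫ x, fderiv ℝ φ x c ^ 2 ∂ν := by
    rw [norm_sq_mul_integral_sq_eq hφ hφc, ← integral_neg, ← integral_const_mul,
      ← integral_const_mul, ← integral_add hiφ hiD]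
    exact integral_mono hi (hiφ.add hiD) young
  linarith

end Poincare

/-! ### Test functions and weak derivatives -/

variable {d : ℕ} {Ω : Set (Space d)}

namespace IsTestFunction

variable {φ ψ : Space d → ℝ}

theorem differentiable (hφ : IsTestFunction Ω φ) : Differentiable ℝ φ :=
  hφ.1.differentiable (by simp)

theorem eq_zero (hφ : IsTestFunction Ω φ) {x : Space d} (hx : x ∉ Ω) : φ x = 0 :=
  image_eq_zero_of_notMem_tsupport fun h => hx (hφ.2.2 h)

theorem continuous_classicalPartial (hφ : IsTestFunction Ω φ) (i : Fin d) :
    Continuous (classicalPartial i φ) :=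
  (hφ.1.continuous_fderiv (by simp)).clm_apply continuous_const

theorem hasCompactSupport_classicalPartial (hφ : IsTestFunction Ω φ) (i : Fin d) :
    HasCompactSupport (classicalPartial i φ) :=
  hφ.2.1.fderiv_apply (𝕜 := ℝ) _

theorem classicalPartial_eq_zero (hφ : IsTestFunction Ω φ) (i : Fin d) {x : Space d}
    (hx : x ∉ Ω) : classicalPartial i φ x = 0 :=
  image_eq_zero_of_notMem_tsupport fun h =>
    hx (((tsupport_fderiv_apply_subset ℝ _).trans hφ.2.2) h)

theorem memL2 (hφ : IsTestFunction Ω φ) : MemL2 Ω φ :=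
  (hφ.1.continuous.memLp_of_hasCompactSupport hφ.2.1).restrict _

theorem memL2_classicalPartial (hφ : IsTestFunction Ω φ) (i : Fin d) :
    MemL2 Ω (classicalPartial i φ) :=
  ((hφ.continuous_classicalPartial i).memLp_of_hasCompactSupport
    (hφ.hasCompactSupport_classicalPartial i)).restrict _

theorem classicalPartial_add (hφ : IsTestFunction Ω φ) (hψ : IsTestFunction Ω ψ) (i : Fin d)
    (x : Space d) :
    classicalPartial i (φ + ψ) x = classicalPartial i φ x + classicalPartial i ψ x := by
  rw [classicalPartial, fderiv_add (hφ.differentiable x) (hψ.differentiable x)]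
  rfl

theorem classicalPartial_smul (hφ : IsTestFunction Ω φ) (c : ℝ) (i : Fin d) (x : Space d) :
    classicalPartial i (c • φ) x = c * classicalPartial i φ x := by
  rw [classicalPartial, fderiv_const_smul (hφ.differentiable x)]
  rfl

theorem add (hφ : IsTestFunction Ω φ) (hψ : IsTestFunction Ω ψ) : IsTestFunction Ω (φ + ψ) :=
  ⟨hφ.1.add hψ.1, hφ.2.1.add hψ.2.1,
    (tsupport_add φ ψ).trans (union_subset hφ.2.2 hψ.2.2)⟩

theorem smul (hφ : IsTestFunction Ω φ) (c : ℝ) : IsTestFunction Ω (c • φ) :=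
  ⟨hφ.1.const_smul c, hφ.2.1.smul_left (f := fun _ => c),
    (tsupport_smul_subset_right (fun _ => c) φ).trans hφ.2.2⟩

theorem sq (hφ : IsTestFunction Ω φ) : IsTestFunction Ω fun x => φ x ^ 2 :=
  ⟨hφ.1.pow 2, hφ.2.1.comp_left (g := (· ^ 2)) (by simp),
    (tsupport_comp_subset (g := (· ^ 2)) (by simp) φ).trans hφ.2.2⟩

theorem exists_lipschitzWith (hφ : IsTestFunction Ω φ) : ∃ K, LipschitzWith K φ :=
  (hφ.1.of_le (m := 1) (by simp)).lipschitzWith_of_hasCompactSupport hφ.2.1 (by simp)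

theorem zero : IsTestFunction Ω (0 : Space d → ℝ) :=
  ⟨contDiff_const, HasCompactSupport.zero, by simp⟩

theorem integral_mul_classicalPartial (hφ : IsTestFunction Ω φ) (hψ : IsTestFunction Ω ψ)
    (i : Fin d) : ∫ x in Ω, φ x * classicalPartial i ψ x =
      - ∫ x in Ω, classicalPartial i φ x * ψ x := by
  rw [setIntegral_eq_integral_of_forall_compl_eq_zero
      (fun x hx => by rw [hφ.eq_zero hx, zero_mul]),
    setIntegral_eq_integral_of_forall_compl_eq_zero
      (fun x hx => by rw [hψ.eq_zero hx, mul_zero])]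
  refine integral_mul_fderiv_eq_neg_fderiv_mul_of_integrable ?_ ?_ ?_
    (fun x _ => hφ.differentiable x) (fun x _ => hψ.differentiable x)
  · exact ((hφ.continuous_classicalPartial i).mul hψ.1.continuous).integrable_of_hasCompactSupport
      hψ.2.1.mul_left
  · exact (hφ.1.continuous.mul (hψ.continuous_classicalPartial i)).integrable_of_hasCompactSupport
      hφ.2.1.mul_right
  · exact (hφ.1.continuous.mul hψ.1.continuous).integrable_of_hasCompactSupport hψ.2.1.mul_left

theorem isWeakPartial (hφ : IsTestFunction Ω φ) (i : Fin d) :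
    IsWeakPartial Ω i φ (classicalPartial i φ) :=
  ⟨hφ.memL2_classicalPartial i, fun _ hψ => hφ.integral_mul_classicalPartial hψ i⟩

end IsTestFunction

theorem MemL2.integrable_mul {v w : Space d → ℝ} (hv : MemL2 Ω v) (hw : MemL2 Ω w) :
    Integrable (fun x => v x * w x) (volume.restrict Ω) :=
  MemLp.integrable_mul hv hw

theorem MemL2.ae_eq_zero (hΩo : IsOpen Ω) {w : Space d → ℝ} (hw : MemL2 Ω w)
    (h : ∀ φ, IsTestFunction Ω φ → ∫ x in Ω, w x * φ x = 0) :
    w =ᵐ[volume.restrict Ω] 0 := by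
  have hloc : LocallyIntegrableOn w Ω :=
    locallyIntegrableOn_of_locallyIntegrable_restrict (MemLp.locallyIntegrable hw one_le_two)
  refine (ae_restrict_iff' hΩo.measurableSet).mpr
    (hΩo.ae_eq_zero_of_integral_contDiff_smul_eq_zero hloc fun φ hφ hφc hφs => ?_)
  have hφ : IsTestFunction Ω φ := ⟨hφ, hφc, hφs⟩
  rw [← h φ hφ, setIntegral_eq_integral_of_forall_compl_eq_zero
    (fun x hx => by rw [hφ.eq_zero hx, mul_zero])]
  simp only [smul_eq_mul, mul_comm]

theorem MemH1.isWeakPartial {v : Space d → ℝ} (hv : MemH1 Ω v) (i : Fin d) :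
    IsWeakPartial Ω i v (weakPartial Ω i v) := by
  rw [weakPartial, dif_pos (hv.2 i)]
  exact (hv.2 i).choose_spec

namespace IsWeakPartial

variable {i : Fin d} {v v' w w' : Space d → ℝ}

theorem ae_eq (hΩo : IsOpen Ω) (hw : IsWeakPartial Ω i v w) (hw' : IsWeakPartial Ω i v' w')
    (hv : v =ᵐ[volume.restrict Ω] v') : w =ᵐ[volume.restrict Ω] w' := by
  have hzero : w - w' =ᵐ[volume.restrict Ω] 0 := by
    refine MemL2.ae_eq_zero hΩo (MemLp.sub hw.1 hw'.1) fun φ hφ => ?_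
    have hv_int : ∫ x in Ω, v x * classicalPartial i φ x =
        ∫ x in Ω, v' x * classicalPartial i φ x :=
      integral_congr_ae (hv.mono fun x hx => by simp only [hx])
    simp only [Pi.sub_apply, sub_mul]
    rw [integral_sub (hw.1.integrable_mul hφ.memL2) (hw'.1.integrable_mul hφ.memL2), sub_eq_zero,
      ← neg_inj, ← hw.2 φ hφ, ← hw'.2 φ hφ, hv_int]
  exact hzero.mono fun x hx => sub_eq_zero.mp hx

theorem add (hv : MemL2 Ω v) (hv' : MemL2 Ω v') (hw : IsWeakPartial Ω i v w)
    (hw' : IsWeakPartial Ω i v' w') : IsWeakPartial Ω i (v + v') (w + w') := by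
  refine ⟨MemLp.add hw.1 hw'.1, fun φ hφ => ?_⟩
  simp only [Pi.add_apply, add_mul]
  rw [integral_add (hv.integrable_mul (hφ.memL2_classicalPartial i))
      (hv'.integrable_mul (hφ.memL2_classicalPartial i)),
    integral_add (hw.1.integrable_mul hφ.memL2) (hw'.1.integrable_mul hφ.memL2),
    hw.2 φ hφ, hw'.2 φ hφ, neg_add]

theorem smul (hw : IsWeakPartial Ω i v w) (c : ℝ) : IsWeakPartial Ω i (c • v) (c • w) := by
  refine ⟨MemLp.const_smul hw.1 c, fun φ hφ => ?_⟩
  simp only [Pi.smul_apply, smul_eq_mul, mul_assoc]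
  rw [integral_const_mul, integral_const_mul, hw.2 φ hφ, mul_neg]

end IsWeakPartial

/-! ### Lipschitz functions of compact support -/

theorem isWeakPartial_lineDeriv (hΩb : Bornology.IsBounded Ω) {f : Space d → ℝ} {L : NNReal}
    (hf : LipschitzWith L f) (i : Fin d) :
    IsWeakPartial Ω i f (fun x => lineDeriv ℝ f x (EuclideanSpace.single i 1)) := by
  have : IsFiniteMeasure (volume.restrict Ω) :=
    isFiniteMeasure_restrict.mpr hΩb.measure_lt_top.ne
  refine ⟨MemLp.of_bound (measurable_lineDeriv hf.continuous).aestronglyMeasurable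
    (L * ‖(EuclideanSpace.single i 1 : Space d)‖)
    (.of_forall fun x => norm_lineDeriv_le_of_lipschitz ℝ hf), fun φ hφ => ?_⟩
  obtain ⟨K, hK⟩ := hφ.exists_lipschitzWith
  rw [setIntegral_eq_integral_of_forall_compl_eq_zero
      (fun x hx => by rw [hφ.classicalPartial_eq_zero i hx, mul_zero]),
    setIntegral_eq_integral_of_forall_compl_eq_zero
      (fun x hx => by rw [hφ.eq_zero hx, mul_zero]),
    hf.integral_lineDeriv_mul_eq (μ := volume) hK hφ.2.1 (EuclideanSpace.single i 1),
    ← integral_neg]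
  refine integral_congr_ae (.of_forall fun x => ?_)
  simp only [map_neg, (hφ.differentiable x).lineDeriv_eq_fderiv, classicalPartial]
  ring

/-- The mollification of a function: its convolution with a normalised bump function. -/
def mollify (ρ : ContDiffBump (0 : Space d)) (f : Space d → ℝ) : Space d → ℝ :=
  convolution (ρ.normed volume) f (ContinuousLinearMap.lsmul ℝ ℝ) volume

section mollify

variable {f : Space d → ℝ}

theorem abs_mollify_le (ρ : ContDiffBump (0 : Space d)) {M : ℝ} (hM : ∀ x, |f x| ≤ M)
    (x : Space d) : |mollify ρ f x| ≤ M := by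
  rw [mollify, convolution_def, ← Real.norm_eq_abs]
  refine (norm_integral_le_of_norm_le (ρ.integrable_normed.mul_const M)
    (.of_forall fun t => ?_)).trans_eq ?_
  · simp only [ContinuousLinearMap.lsmul_apply, smul_eq_mul, norm_mul, Real.norm_eq_abs,
      abs_of_nonneg (ρ.nonneg_normed t)]
    exact mul_le_mul_of_nonneg_left (hM _) (ρ.nonneg_normed t)
  · rw [integral_mul_const, ρ.integral_normed, one_mul]

theorem contDiff_mollify (ρ : ContDiffBump (0 : Space d)) (hf : LocallyIntegrable f) :
    ContDiff ℝ ((⊤ : ℕ∞) : WithTop ℕ∞) (mollify ρ f) :=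
  ρ.hasCompactSupport_normed.contDiff_convolution_left _ ρ.contDiff_normed hf

theorem fderiv_mollify_apply (ρ : ContDiffBump (0 : Space d)) (hf : LocallyIntegrable f)
    (x e : Space d) :
    fderiv ℝ (mollify ρ f) x e = ∫ t, fderiv ℝ (ρ.normed volume) t e * f (x - t) := by
  have hρ : ContDiff ℝ 1 (ρ.normed (volume : Measure (Space d))) := ρ.contDiff_normed
  have hint := HasCompactSupport.convolutionExists_left (μ := volume)
    ((ContinuousLinearMap.lsmul ℝ ℝ : ℝ →L[ℝ] ℝ →L[ℝ] ℝ).precompL (Space d))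
    (ρ.hasCompactSupport_normed.fderiv ℝ) (hρ.continuous_fderiv one_ne_zero) hf x
  rw [mollify, (ρ.hasCompactSupport_normed.hasFDerivAt_convolution_left
    (ContinuousLinearMap.lsmul ℝ ℝ) hρ hf x).fderiv, convolution_def,
    ContinuousLinearMap.integral_apply hint]
  simp only [ContinuousLinearMap.precompL_apply, ContinuousLinearMap.lsmul_apply, smul_eq_mul]

theorem lineDeriv_comp_const_sub {E F : Type*} [AddCommGroup E] [Module ℝ E]
    [NormedAddCommGroup F] [NormedSpace ℝ F] (f : E → F) (x t e : E) :
    lineDeriv ℝ (fun t => f (x - t)) t (-e) = lineDeriv ℝ f (x - t) e := by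
  simp only [lineDeriv, smul_neg, ← sub_eq_add_neg, sub_sub_eq_add_sub, add_sub_right_comm]

theorem classicalPartial_mollify (ρ : ContDiffBump (0 : Space d)) {L : NNReal}
    (hf : LipschitzWith L f) (i : Fin d) (x : Space d) :
    classicalPartial i (mollify ρ f) x =
      mollify ρ (fun y => lineDeriv ℝ f y (EuclideanSpace.single i 1)) x := by
  have hρ : ContDiff ℝ 1 (ρ.normed (volume : Measure (Space d))) := ρ.contDiff_normed
  obtain ⟨K, hK⟩ := hρ.lipschitzWith_of_hasCompactSupport
    (ρ.hasCompactSupport_normed (μ := volume)) one_ne_zero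
  have hfx : LipschitzWith L (fun t => f (x - t)) := LipschitzWith.of_dist_le_mul fun s t => by
    simpa only [dist_sub_left] using hf.dist_le_mul (x - s) (x - t)
  have hparts := hfx.integral_lineDeriv_mul_eq (μ := volume) hK ρ.hasCompactSupport_normed
    (-EuclideanSpace.single i 1)
  simp only [neg_neg, lineDeriv_comp_const_sub,
    ((hρ.differentiable one_ne_zero) _).lineDeriv_eq_fderiv] at hparts
  rw [classicalPartial, fderiv_mollify_apply ρ hf.continuous.locallyIntegrable, ← hparts, mollify,
    convolution_def]
  simp only [ContinuousLinearMap.lsmul_apply, smul_eq_mul, mul_comm]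

theorem isTestFunction_mollify (ρ : ContDiffBump (0 : Space d)) (hf : LocallyIntegrable f)
    (hfc : HasCompactSupport f) (hρ : Metric.cthickening ρ.rOut (tsupport f) ⊆ Ω) :
    IsTestFunction Ω (mollify ρ f) := by
  refine ⟨contDiff_mollify ρ hf, ρ.hasCompactSupport_normed.convolution _ hfc,
    subset_trans (closure_minimal ?_ Metric.isClosed_cthickening) hρ⟩
  refine (support_convolution_subset _).trans ?_
  rintro x ⟨a, ha, b, hb, rfl⟩
  refine Metric.mem_cthickening_of_dist_le _ b _ _ (subset_tsupport f hb) ?_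
  rw [ρ.support_normed_eq, Metric.mem_ball, dist_zero_right] at ha
  simpa using ha.le

theorem exists_seq_contDiffBump (d : ℕ) : ∃ ρ : ℕ → ContDiffBump (0 : Space d),
    Tendsto (fun n => (ρ n).rOut) atTop (𝓝 0) ∧ ∀ n, (ρ n).rOut ≤ 2 * (ρ n).rIn :=
  ⟨fun n => ⟨1 / ((n : ℝ) + 1) / 2, 1 / ((n : ℝ) + 1), by positivity, half_lt_self (by positivity)⟩,
    tendsto_one_div_add_atTop_nhds_zero_nat, fun _ => (mul_div_cancel₀ _ two_ne_zero).ge⟩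

theorem tendsto_integral_sq_sub_mollify (hΩb : Bornology.IsBounded Ω)
    {ρ : ℕ → ContDiffBump (0 : Space d)} {K M : ℝ}
    (hρ : Tendsto (fun n => (ρ n).rOut) atTop (𝓝 0)) (hρK : ∀ n, (ρ n).rOut ≤ K * (ρ n).rIn)
    (hf : Measurable f) (hM : ∀ x, |f x| ≤ M) :
    Tendsto (fun n => ∫ x in Ω, (f x - mollify (ρ n) f x) ^ 2) atTop (𝓝 0) := by
  have : IsFiniteMeasure (volume.restrict Ω) :=
    isFiniteMeasure_restrict.mpr hΩb.measure_lt_top.ne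
  have hloc : LocallyIntegrable f :=
    (memLp_top_of_bound hf.aestronglyMeasurable M (.of_forall hM)).locallyIntegrable le_top
  rw [← integral_zero (Space d) ℝ (μ := volume.restrict Ω)]
  refine tendsto_integral_of_dominated_convergence (fun _ => (M + M) ^ 2)
    (fun n => ((hf.sub (contDiff_mollify (ρ n) hloc).continuous.measurable).pow_const
      2).aestronglyMeasurable)
    (integrable_const _) (fun n => .of_forall fun x => ?_) (ae_restrict_of_ae ?_)
  · rw [Real.norm_eq_abs, abs_pow]
    gcongr
    exact (abs_sub _ _).trans (add_le_add (hM x) (abs_mollify_le _ hM x))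
  · filter_upwards [ContDiffBump.ae_convolution_tendsto_right_of_locallyIntegrable hρ
      (.of_forall hρK) hloc] with x hx
    have hsub : Tendsto (fun n => (f x - mollify (ρ n) f x) ^ 2) atTop (𝓝 ((f x - f x) ^ 2)) :=
      (tendsto_const_nhds.sub hx).pow 2
    simpa only [sub_self, ne_eq, OfNat.ofNat_ne_zero, not_false_eq_true, zero_pow] using hsub

theorem memH10_of_lipschitzWith (hΩo : IsOpen Ω) (hΩb : Bornology.IsBounded Ω) {L : NNReal}
    (hf : LipschitzWith L f) (hfc : HasCompactSupport f) (hfs : tsupport f ⊆ Ω) :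
    MemH10 Ω f := by
  have hpartial := fun i => isWeakPartial_lineDeriv hΩb hf i
  have hH1 : MemH1 Ω f :=
    ⟨(hf.continuous.memLp_of_hasCompactSupport hfc).restrict _, fun i => ⟨_, hpartial i⟩⟩
  refine ⟨hH1, fun ε hε => ?_⟩
  obtain ⟨ρ, hρ, hρ2⟩ := exists_seq_contDiffBump d
  obtain ⟨δ, hδ, hδΩ⟩ := hfc.isCompact.exists_cthickening_subset_open hΩo hfs
  obtain ⟨M, hM⟩ := hf.continuous.bounded_above_of_compact_support hfc
  have htest : ∀ᶠ n in atTop, IsTestFunction Ω (mollify (ρ n) f) := by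
    filter_upwards [hρ.eventually_lt_const hδ] with n hn
    exact isTestFunction_mollify _ hf.continuous.locallyIntegrable hfc
      ((Metric.cthickening_mono hn.le _).trans hδΩ)
  have hlim : Tendsto (fun n => ∫ x in Ω, (f x - mollify (ρ n) f x) ^ 2) atTop (𝓝 0) :=
    tendsto_integral_sq_sub_mollify hΩb hρ hρ2 hf.continuous.measurable hM
  have hlim_partial : ∀ i, Tendsto (fun n => ∫ x in Ω, (weakPartial Ω i f x -
      classicalPartial i (mollify (ρ n) f) x) ^ 2) atTop (𝓝 0) := by
    intro i
    refine (tendsto_integral_sq_sub_mollify hΩb hρ hρ2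
      (measurable_lineDeriv (𝕜 := ℝ) (v := EuclideanSpace.single i 1) hf.continuous)
      fun x => norm_lineDeriv_le_of_lipschitz ℝ hf).congr fun n => integral_congr_ae ?_
    filter_upwards [(hH1.isWeakPartial i).ae_eq hΩo (hpartial i) (ae_eq_refl _)] with x hx
    rw [hx, classicalPartial_mollify _ hf]
  have hsum := hlim.add (tendsto_finsetSum Finset.univ fun i _ => hlim_partial i)
  simp only [Finset.sum_const_zero, add_zero] at hsum
  obtain ⟨n, hn, hn_lt⟩ := (htest.and (hsum.eventually_lt_const hε)).exists
  exact ⟨_, hn, hn_lt⟩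

end mollify

/-! ### `H¹₀` as a Hilbert space -/

/-- Pairs of a square-integrable function and a square-integrable vector field. -/
abbrev L2Pair (Ω : Set (Space d)) :=
  WithLp 2 (Lp ℝ 2 (volume.restrict Ω) × Lp (Space d) 2 (volume.restrict Ω))

/-- The pair of classes of a square-integrable function and a square-integrable vector field. -/
def mkPair {v : Space d → ℝ} {g : Space d → Space d} (hv : MemL2 Ω v)
    (hg : MemLp g 2 (volume.restrict Ω)) : L2Pair Ω :=
  WithLp.toLp 2 (MemLp.toLp v hv, hg.toLp g)

section mkPair

variable {v v' : Space d → ℝ} {g g' : Space d → Space d} (hv : MemL2 Ω v) (hv' : MemL2 Ω v')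
  (hg : MemLp g 2 (volume.restrict Ω)) (hg' : MemLp g' 2 (volume.restrict Ω))

theorem mkPair_congr (hvv' : v =ᵐ[volume.restrict Ω] v') (hgg' : g =ᵐ[volume.restrict Ω] g') :
    mkPair hv hg = mkPair hv' hg' := by
  rw [mkPair, mkPair, MemLp.toLp_congr hv hv' hvv', MemLp.toLp_congr hg hg' hgg']

theorem norm_sq_mkPair :
    ‖mkPair hv hg‖ ^ 2 = (∫ x in Ω, v x ^ 2) + ∑ i, ∫ x in Ω, g x i ^ 2 := by
  rw [WithLp.prod_norm_sq_eq_of_L2, ← integral_finsetSum _ fun i _ =>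
    (hg.eval_piLp i).integrable_sq]
  simp only [← EuclideanSpace.real_norm_sq_eq]
  exact congrArg₂ (· + ·) (norm_sq_Lp_real_eq_integral (MemLp.coeFn_toLp hv))
    (norm_sq_Lp_eq_integral (MemLp.coeFn_toLp hg))

end mkPair

/-- The classical gradient. -/
def classicalGrad (φ : Space d → ℝ) (x : Space d) : Space d :=
  WithLp.toLp 2 fun i => classicalPartial i φ x

theorem sum_mul_classicalPartial (φ : Space d → ℝ) (c x : Space d) :
    ∑ i, c i * classicalPartial i φ x = fderiv ℝ φ x c := by
  have hc : c = ∑ i, c i • (EuclideanSpace.single i (1 : ℝ) : Space d) := by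
    ext j
    simp [Finset.sum_apply, Pi.single_apply]
  conv_rhs => rw [hc]
  simp [classicalPartial]

theorem inner_classicalGrad (φ : Space d → ℝ) (c x : Space d) :
    inner ℝ c (classicalGrad φ x) = fderiv ℝ φ x c := by
  simp only [← sum_mul_classicalPartial, PiLp.inner_apply, classicalGrad, RCLike.inner_apply,
    conj_trivial, mul_comm]

namespace IsTestFunction

variable {φ ψ : Space d → ℝ}

theorem memLp_classicalGrad (hφ : IsTestFunction Ω φ) :
    MemLp (classicalGrad φ) 2 (volume.restrict Ω) :=
  MemLp.of_eval_piLp fun i => hφ.memL2_classicalPartial i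

theorem integral_sq (hφ : IsTestFunction Ω φ) : ∫ x in Ω, φ x ^ 2 = ∫ x, φ x ^ 2 :=
  setIntegral_eq_integral_of_forall_compl_eq_zero fun x hx => by simp [hφ.eq_zero hx]

theorem integral_fderiv_sq (hφ : IsTestFunction Ω φ) (c : Space d) :
    ∫ x in Ω, fderiv ℝ φ x c ^ 2 = ∫ x, fderiv ℝ φ x c ^ 2 :=
  setIntegral_eq_integral_of_forall_compl_eq_zero fun x hx => by
    simp [fderiv_of_notMem_tsupport ℝ fun h => hx (hφ.2.2 h)]

end IsTestFunction

/-- The pairs `(φ, ∇φ)` of test functions. -/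
def testPairs (Ω : Set (Space d)) : Submodule ℝ (L2Pair Ω) where
  carrier := {e | ∃ φ, ∃ hφ : IsTestFunction Ω φ, e = mkPair hφ.memL2 hφ.memLp_classicalGrad}
  add_mem' := by
    rintro _ _ ⟨φ, hφ, rfl⟩ ⟨ψ, hψ, rfl⟩
    refine ⟨φ + ψ, hφ.add hψ, mkPair_congr (MemLp.add hφ.memL2 hψ.memL2) _
      (hφ.memLp_classicalGrad.add hψ.memLp_classicalGrad) _ ae_eq_rfl (.of_forall fun x => ?_)⟩
    ext i
    exact (hφ.classicalPartial_add hψ i x).symm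
  zero_mem' := by
    refine ⟨0, IsTestFunction.zero, mkPair_congr MemLp.zero _ MemLp.zero _ ae_eq_rfl
      (.of_forall fun x => ?_)⟩
    ext i
    simp [classicalGrad, classicalPartial]
  smul_mem' := by
    rintro c _ ⟨φ, hφ, rfl⟩
    refine ⟨c • φ, hφ.smul c, mkPair_congr (MemLp.const_smul hφ.memL2 c) _
      (hφ.memLp_classicalGrad.const_smul c) _ ae_eq_rfl (.of_forall fun x => ?_)⟩
    ext i
    exact (hφ.classicalPartial_smul c i x).symm

/-- The Hilbert space `H¹₀(Ω)`, encoded as the closure of the pairs `(φ, ∇φ)` of test functions in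
`L² × (L²)^d`; its elements are the pairs `(v, ∇v)` with `v ∈ H¹₀(Ω)`. -/
def H10Space (Ω : Set (Space d)) : Submodule ℝ (L2Pair Ω) :=
  (testPairs Ω).topologicalClosure

instance : CompleteSpace (H10Space Ω) :=
  (Submodule.isClosed_topologicalClosure _).completeSpace_coe

/-- A test function as an element of the Hilbert space `H¹₀(Ω)`. -/
def IsTestFunction.toH10 {φ : Space d → ℝ} (hφ : IsTestFunction Ω φ) : H10Space Ω :=
  ⟨mkPair hφ.memL2 hφ.memLp_classicalGrad, subset_closure ⟨φ, hφ, rfl⟩⟩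

namespace H10Space

/-- The embedding of `H¹₀(Ω)` into `L²(Ω)`. -/
def toL2 (Ω : Set (Space d)) : H10Space Ω →L[ℝ] Lp ℝ 2 (volume.restrict Ω) :=
  (WithLp.fstL 2 ℝ _ _).comp (H10Space Ω).subtypeL

/-- The weak gradient as an operator on `H¹₀(Ω)`. -/
def grad (Ω : Set (Space d)) : H10Space Ω →L[ℝ] Lp (Space d) 2 (volume.restrict Ω) :=
  (WithLp.sndL 2 ℝ _ _).comp (H10Space Ω).subtypeL

theorem norm_sq_eq (e : H10Space Ω) : ‖e‖ ^ 2 = ‖toL2 Ω e‖ ^ 2 + ‖grad Ω e‖ ^ 2 :=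
  WithLp.prod_norm_sq_eq_of_L2 (e : L2Pair Ω)

theorem toL2_toH10_ae_eq {φ : Space d → ℝ} (hφ : IsTestFunction Ω φ) :
    toL2 Ω hφ.toH10 =ᵐ[volume.restrict Ω] φ :=
  MemLp.coeFn_toLp hφ.memL2

theorem grad_toH10_ae_eq {φ : Space d → ℝ} (hφ : IsTestFunction Ω φ) :
    grad Ω hφ.toH10 =ᵐ[volume.restrict Ω] classicalGrad φ :=
  MemLp.coeFn_toLp hφ.memLp_classicalGrad

theorem induction {P : H10Space Ω → Prop} (hP : IsClosed {e | P e})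
    (h : ∀ φ (hφ : IsTestFunction Ω φ), P hφ.toH10) (e : H10Space Ω) : P e := by
  have hdense : Dense {e : H10Space Ω | (e : L2Pair Ω) ∈ testPairs Ω} := by
    rw [Subtype.dense_iff]
    refine fun e he => closure_mono (fun e' he' => ?_) he
    exact ⟨⟨e', subset_closure he'⟩, he', rfl⟩
  refine hP.closure_subset_iff.mpr ?_ (hdense e)
  rintro ⟨_, _⟩ ⟨φ, hφ, rfl⟩
  exact h φ hφ

theorem isWeakPartial (e : H10Space Ω) (i : Fin d) :
    IsWeakPartial Ω i (toL2 Ω e) (fun x => grad Ω e x i) := by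
  refine ⟨(Lp.memLp (grad Ω e)).eval_piLp i, fun ψ hψ => ?_⟩
  have hi : MemLp (fun _ : Space d => EuclideanSpace.single i (1 : ℝ)) ⊤ (volume.restrict Ω) :=
    memLp_top_const _
  have inner_toL2 : ∀ {e v}, toL2 Ω e =ᵐ[volume.restrict Ω] v →
      inner ℝ (toL2 Ω e) (MemLp.toLp _ (hψ.memL2_classicalPartial i)) =
        ∫ x in Ω, v x * classicalPartial i ψ x :=
    fun hv => inner_Lp_real_eq_integral hv (MemLp.coeFn_toLp _)
  have inner_grad : ∀ {e g}, grad Ω e =ᵐ[volume.restrict Ω] g →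
      inner ℝ (innerLp hi (grad Ω e)) (MemLp.toLp _ hψ.memL2) = ∫ x in Ω, g x i * ψ x :=
    fun hg => (inner_Lp_real_eq_integral (innerLp_ae_eq hi hg) (MemLp.coeFn_toLp _)).trans
      (by simp [EuclideanSpace.inner_single_left])
  rw [← inner_toL2 ae_eq_rfl, ← inner_grad ae_eq_rfl]
  induction e using H10Space.induction with
  | hP => exact isClosed_eq (by fun_prop) (by fun_prop)
  | h φ hφ =>
    rw [inner_toL2 (toL2_toH10_ae_eq hφ), inner_grad (grad_toH10_ae_eq hφ),
      hφ.integral_mul_classicalPartial hψ i]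
    rfl

theorem toL2_injective (hΩo : IsOpen Ω) : Function.Injective (toL2 Ω) := by
  refine (injective_iff_map_eq_zero (toL2 Ω)).mpr fun e he => ?_
  have hzero : toL2 Ω e =ᵐ[volume.restrict Ω] toL2 Ω 0 := by rw [he, map_zero]
  have hpartial : ∀ i, (fun x => grad Ω e x i) =ᵐ[volume.restrict Ω] fun x => grad Ω 0 x i :=
    fun i => (isWeakPartial e i).ae_eq hΩo (isWeakPartial 0 i) hzero
  have hgrad : grad Ω e = grad Ω 0 := by
    refine Lp.ext ?_
    filter_upwards [eventually_all.mpr hpartial] with x hx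
    ext i
    exact hx i
  have hnorm := norm_sq_eq e
  rw [he, hgrad, map_zero, norm_zero, norm_zero] at hnorm
  exact norm_eq_zero.mp (pow_eq_zero_iff two_ne_zero |>.mp (by linarith))

theorem norm_sq_mul_norm_toL2_sq_le {R : ℝ} (hR : ∀ x ∈ Ω, ‖x‖ ≤ R) {c : Space d}
    {a : Space d → Space d} (ha : MemLp a ⊤ (volume.restrict Ω))
    (hac : ∀ᵐ x ∂volume.restrict Ω, a x = c) (e : H10Space Ω) :
    ‖c‖ ^ 2 * ‖toL2 Ω e‖ ^ 2 ≤ 4 * R ^ 2 * ‖innerLp ha (grad Ω e)‖ ^ 2 := by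
  induction e using H10Space.induction with
  | hP => exact isClosed_le (by fun_prop) (by fun_prop)
  | h φ hφ =>
    have hadv : innerLp ha (grad Ω hφ.toH10) =ᵐ[volume.restrict Ω] fun x => fderiv ℝ φ x c := by
      filter_upwards [innerLp_ae_eq ha (grad_toH10_ae_eq hφ), hac] with x hx hacx
      rw [hx, hacx, inner_classicalGrad]
    rw [norm_sq_Lp_real_eq_integral (toL2_toH10_ae_eq hφ), norm_sq_Lp_real_eq_integral hadv,
      hφ.integral_sq, hφ.integral_fderiv_sq]
    exact norm_sq_mul_integral_sq_le (hφ.1.of_le (by simp)) hφ.2.1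
      (fun x hx => hR x (not_imp_comm.mp (fun h => hφ.eq_zero h) hx)) c

theorem exists_norm_toL2_sq_le (hd : 1 ≤ d) (hΩb : Bornology.IsBounded Ω) :
    ∃ C ≥ 0, ∀ e : H10Space Ω, ‖toL2 Ω e‖ ^ 2 ≤ C * ‖grad Ω e‖ ^ 2 := by
  obtain ⟨R, hR⟩ := hΩb.exists_norm_le
  have hb : ‖(EuclideanSpace.single ⟨0, hd⟩ 1 : Space d)‖ = 1 := by simp
  refine ⟨4 * R ^ 2, by positivity, fun e => ?_⟩
  calc ‖toL2 Ω e‖ ^ 2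
      = ‖(EuclideanSpace.single ⟨0, hd⟩ 1 : Space d)‖ ^ 2 * ‖toL2 Ω e‖ ^ 2 := by
        rw [hb, one_pow, one_mul]
    _ ≤ 4 * R ^ 2 * ‖innerLp (memLp_top_const _) (grad Ω e)‖ ^ 2 :=
        norm_sq_mul_norm_toL2_sq_le hR _ (.of_forall fun _ => rfl) e
    _ ≤ 4 * R ^ 2 * (1 * ‖grad Ω e‖) ^ 2 := by
        gcongr
        exact norm_innerLp_le _ (.of_forall fun _ => hb.le) _
    _ = 4 * R ^ 2 * ‖grad Ω e‖ ^ 2 := by rw [one_mul]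

/-! ### The bilinear forms on `H¹₀` -/

section Forms

variable {a : Space d → Space d} (ha : MemLp a ⊤ (volume.restrict Ω)) {μ : Space d → ℝ}
  (hμ : MemLp μ ⊤ (volume.restrict Ω))

/-- The bilinear form `(a · ∇u, v) + (μ ∇u, ∇v)` on the Hilbert space `H¹₀(Ω)`. -/
def bilinForm : H10Space Ω →L[ℝ] H10Space Ω →L[ℝ] ℝ :=
  (innerSL ℝ).bilinearComp ((innerLp ha).comp (grad Ω)) (toL2 Ω) +
    (innerSL ℝ).bilinearComp ((smulLp hμ).comp (grad Ω)) (grad Ω)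

/-- The stabilisation form `(a · ∇u, a · ∇v)` on the Hilbert space `H¹₀(Ω)`. -/
def stabForm : H10Space Ω →L[ℝ] H10Space Ω →L[ℝ] ℝ :=
  (innerSL ℝ).bilinearComp ((innerLp ha).comp (grad Ω)) ((innerLp ha).comp (grad Ω))

theorem bilinForm_apply (e e' : H10Space Ω) :
    bilinForm ha hμ e e' = inner ℝ (innerLp ha (grad Ω e)) (toL2 Ω e') +
      inner ℝ (smulLp hμ (grad Ω e)) (grad Ω e') := rfl

theorem stabForm_apply (e e' : H10Space Ω) :
    stabForm ha e e' = inner ℝ (innerLp ha (grad Ω e)) (innerLp ha (grad Ω e')) := rfl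

theorem stabForm_self_nonneg (e : H10Space Ω) : 0 ≤ stabForm ha e e := by
  rw [stabForm_apply]
  exact real_inner_self_nonneg

/-- For a test function, `2 (a · ∇φ) φ = a · ∇(φ²)` has integral zero since `∇ · a = 0`. -/
theorem inner_innerLp_grad_toL2_self (hdiv : IsDivFree Ω a) (e : H10Space Ω) :
    inner ℝ (innerLp ha (grad Ω e)) (toL2 Ω e) = 0 := by
  induction e using H10Space.induction with
  | hP => exact isClosed_eq (by fun_prop) continuous_const
  | h φ hφ =>
    have hint := hdiv _ hφ.sq
    simp only [sum_mul_classicalPartial, fderiv_sq_apply (hφ.differentiable _)] at hint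
    rw [inner_Lp_real_eq_integral (innerLp_ae_eq ha (grad_toH10_ae_eq hφ)) (toL2_toH10_ae_eq hφ)]
    simp only [inner_classicalGrad]
    have htwo : ∫ x in Ω, 2 * (fderiv ℝ φ x (a x) * φ x) = 0 := by
      rw [← hint]
      exact integral_congr_ae (.of_forall fun x => by ring)
    rw [integral_const_mul] at htwo
    linarith

theorem isCoercive_bilinForm (hd : 1 ≤ d) (hΩb : Bornology.IsBounded Ω) (hdiv : IsDivFree Ω a)
    {μ₀ : ℝ} (hμ₀ : 0 < μ₀) (hμ_ge : ∀ᵐ x ∂volume.restrict Ω, μ₀ ≤ μ x) :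
    IsCoercive (bilinForm ha hμ) := by
  obtain ⟨C, hC₀, hC⟩ := exists_norm_toL2_sq_le hd hΩb
  refine ⟨μ₀ / (C + 1), by positivity, fun e => ?_⟩
  rw [bilinForm_apply, inner_innerLp_grad_toL2_self ha hdiv, zero_add]
  calc μ₀ / (C + 1) * ‖e‖ * ‖e‖ = μ₀ * (‖toL2 Ω e‖ ^ 2 + ‖grad Ω e‖ ^ 2) / (C + 1) := by
        rw [← norm_sq_eq]
        ring
    _ ≤ μ₀ * ‖grad Ω e‖ ^ 2 := by
        rw [div_le_iff₀ (by positivity), mul_assoc]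
        gcongr
        linarith [hC e]
    _ ≤ inner ℝ (smulLp hμ (grad Ω e)) (grad Ω e) := mul_norm_sq_le_inner_smulLp hμ hμ_ge _

end Forms

end H10Space

/-! ### Functions in `H¹₀` as elements of the Hilbert space -/

namespace MemH1

variable {v w : Space d → ℝ}

theorem memLp_weakGrad (hv : MemH1 Ω v) : MemLp (weakGrad Ω v) 2 (volume.restrict Ω) :=
  MemLp.of_eval_piLp fun i => (hv.isWeakPartial i).1

/-- The pair `(v, ∇v)`. -/
def pair (hv : MemH1 Ω v) : L2Pair Ω :=
  mkPair hv.1 hv.memLp_weakGrad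

theorem pair_eq_mkPair (hΩo : IsOpen Ω) (hv : MemH1 Ω v) {g : Space d → Space d}
    (hg : MemLp g 2 (volume.restrict Ω)) (hvg : ∀ i, IsWeakPartial Ω i v fun x => g x i) :
    hv.pair = mkPair hv.1 hg := by
  refine mkPair_congr _ _ _ _ ae_eq_rfl ?_
  have hpartial := fun i => (hv.isWeakPartial i).ae_eq hΩo (hvg i) ae_eq_rfl
  filter_upwards [eventually_all.mpr hpartial] with x hx
  ext i
  exact hx i

theorem add (hv : MemH1 Ω v) (hw : MemH1 Ω w) : MemH1 Ω (v + w) :=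
  ⟨MemLp.add hv.1 hw.1, fun i => ⟨_, (hv.isWeakPartial i).add hv.1 hw.1 (hw.isWeakPartial i)⟩⟩

theorem smul (hv : MemH1 Ω v) (c : ℝ) : MemH1 Ω (c • v) :=
  ⟨MemLp.const_smul hv.1 c, fun i => ⟨_, (hv.isWeakPartial i).smul c⟩⟩

theorem pair_add (hΩo : IsOpen Ω) (hv : MemH1 Ω v) (hw : MemH1 Ω w) :
    (hv.add hw).pair = hv.pair + hw.pair :=
  (hv.add hw).pair_eq_mkPair hΩo (hv.memLp_weakGrad.add hw.memLp_weakGrad) fun i =>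
    (hv.isWeakPartial i).add hv.1 hw.1 (hw.isWeakPartial i)

theorem pair_smul (hΩo : IsOpen Ω) (hv : MemH1 Ω v) (c : ℝ) :
    (hv.smul c).pair = c • hv.pair :=
  (hv.smul c).pair_eq_mkPair hΩo (hv.memLp_weakGrad.const_smul c) fun i =>
    (hv.isWeakPartial i).smul c

theorem norm_sq_pair_sub (hv : MemH1 Ω v) {φ : Space d → ℝ} (hφ : IsTestFunction Ω φ) :
    ‖hv.pair - mkPair hφ.memL2 hφ.memLp_classicalGrad‖ ^ 2 = (∫ x in Ω, (v x - φ x) ^ 2) +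
      ∑ i, ∫ x in Ω, (weakPartial Ω i v x - classicalPartial i φ x) ^ 2 :=
  norm_sq_mkPair (MemLp.sub hv.1 hφ.memL2) (hv.memLp_weakGrad.sub hφ.memLp_classicalGrad)

theorem memH10_iff (hv : MemH1 Ω v) : MemH10 Ω v ↔ hv.pair ∈ H10Space Ω := by
  constructor
  · rintro ⟨-, h⟩
    refine Metric.mem_closure_iff.mpr fun ε hε => ?_
    obtain ⟨φ, hφ, hlt⟩ := h (ε ^ 2) (by positivity)
    refine ⟨_, ⟨φ, hφ, rfl⟩, ?_⟩
    rw [← hv.norm_sq_pair_sub hφ] at hlt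
    rw [dist_eq_norm]
    exact lt_of_pow_lt_pow_left₀ 2 hε.le hlt
  · intro h
    refine ⟨hv, fun ε hε => ?_⟩
    obtain ⟨_, ⟨φ, hφ, rfl⟩, hlt⟩ := Metric.mem_closure_iff.mp h (√ε) (Real.sqrt_pos.mpr hε)
    refine ⟨φ, hφ, ?_⟩
    rw [← hv.norm_sq_pair_sub hφ, ← dist_eq_norm]
    exact (Real.lt_sqrt dist_nonneg).mp hlt

end MemH1

theorem IsTestFunction.memH10 (hΩo : IsOpen Ω) {φ : Space d → ℝ} (hφ : IsTestFunction Ω φ) :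
    MemH10 Ω φ := by
  have hφ₁ : MemH1 Ω φ := ⟨hφ.memL2, fun i => ⟨_, hφ.isWeakPartial i⟩⟩
  rw [hφ₁.memH10_iff, hφ₁.pair_eq_mkPair hΩo hφ.memLp_classicalGrad hφ.isWeakPartial]
  exact hφ.toH10.2

theorem memL2_advect {a : Space d → Space d} (ha : MemLp a ⊤ (volume.restrict Ω))
    {v : Space d → ℝ} (hv : MemH1 Ω v) : MemL2 Ω (advect Ω a v) :=
  (memLp_congr_ae (innerLp_ae_eq ha (MemLp.coeFn_toLp hv.memLp_weakGrad))).mp (Lp.memLp _)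

namespace MemH10

variable {v w : Space d → ℝ}

theorem add (hΩo : IsOpen Ω) (hv : MemH10 Ω v) (hw : MemH10 Ω w) : MemH10 Ω (v + w) := by
  rw [(hv.1.add hw.1).memH10_iff, MemH1.pair_add hΩo hv.1 hw.1]
  exact add_mem (hv.1.memH10_iff.mp hv) (hw.1.memH10_iff.mp hw)

theorem smul (hΩo : IsOpen Ω) (hv : MemH10 Ω v) (c : ℝ) : MemH10 Ω (c • v) := by
  rw [(hv.1.smul c).memH10_iff, MemH1.pair_smul hΩo hv.1]
  exact Submodule.smul_mem _ c (hv.1.memH10_iff.mp hv)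

/-- The element `(v, ∇v)` of the Hilbert space `H¹₀(Ω)`. -/
def toH10 (hv : MemH10 Ω v) : H10Space Ω :=
  ⟨hv.1.pair, hv.1.memH10_iff.mp hv⟩

theorem toL2_toH10_ae_eq (hv : MemH10 Ω v) :
    H10Space.toL2 Ω hv.toH10 =ᵐ[volume.restrict Ω] v :=
  MemLp.coeFn_toLp hv.1.1

theorem grad_toH10_ae_eq (hv : MemH10 Ω v) :
    H10Space.grad Ω hv.toH10 =ᵐ[volume.restrict Ω] weakGrad Ω v :=
  MemLp.coeFn_toLp hv.1.memLp_weakGrad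

theorem innerLp_grad_toH10_ae_eq {a : Space d → Space d} (ha : MemLp a ⊤ (volume.restrict Ω))
    (hv : MemH10 Ω v) :
    innerLp ha (H10Space.grad Ω hv.toH10) =ᵐ[volume.restrict Ω] advect Ω a v :=
  innerLp_ae_eq ha hv.grad_toH10_ae_eq

end MemH10

/-- `H¹₀(Ω)` as a space of functions. -/
def H10Fun (hΩo : IsOpen Ω) : Submodule ℝ (Space d → ℝ) where
  carrier := {v | MemH10 Ω v}
  add_mem' hv hw := hv.add hΩo hw
  zero_mem' := IsTestFunction.zero.memH10 hΩo
  smul_mem' c _ hv := hv.smul hΩo c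

/-- The linear map `v ↦ (v, ∇v)` from functions to the Hilbert space `H¹₀(Ω)`. -/
def H10Fun.toH10Space (hΩo : IsOpen Ω) : H10Fun hΩo →ₗ[ℝ] H10Space Ω where
  toFun v := MemH10.toH10 v.2
  map_add' v w := Subtype.ext (MemH1.pair_add hΩo v.2.1 w.2.1)
  map_smul' c v := Subtype.ext (MemH1.pair_smul hΩo v.2.1 c)

namespace H10Space

variable {a : Space d → Space d} (ha : MemLp a ⊤ (volume.restrict Ω)) {v w : Space d → ℝ}

theorem bilinForm_toH10 {μ : Space d → ℝ} (hμ : MemLp μ ⊤ (volume.restrict Ω))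
    (hv : MemH10 Ω v) (hw : MemH10 Ω w) :
    bilinForm ha hμ hv.toH10 hw.toH10 = bilin Ω a μ v w := by
  rw [bilinForm_apply,
    inner_Lp_real_eq_integral (hv.innerLp_grad_toH10_ae_eq ha) hw.toL2_toH10_ae_eq,
    inner_Lp_eq_integral (smulLp_ae_eq hμ hv.grad_toH10_ae_eq) hw.grad_toH10_ae_eq]
  simp only [inner_smul_left, conj_trivial, bilin]

theorem stabForm_toH10 (hv : MemH10 Ω v) (hw : MemH10 Ω w) :
    stabForm ha hv.toH10 hw.toH10 = ∫ x in Ω, advect Ω a v x * advect Ω a w x := by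
  rw [stabForm_apply, inner_Lp_real_eq_integral (hv.innerLp_grad_toH10_ae_eq ha)
    (hw.innerLp_grad_toH10_ae_eq ha)]

theorem stabForm_toH10_ne_zero (hv : MemH10 Ω v)
    (hadv : ¬ ∀ᵐ x ∂volume.restrict Ω, advect Ω a v x = 0) : stabForm ha hv.toH10 ≠ 0 := by
  intro hS
  have hself : ∫ x in Ω, advect Ω a v x * advect Ω a v x = 0 := by
    rw [← stabForm_toH10 ha hv hv, hS]
    rfl
  refine hadv ?_
  filter_upwards [(integral_eq_zero_iff_of_nonneg (fun x => mul_self_nonneg (advect Ω a v x))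
    ((memL2_advect ha hv.1).integrable_mul (memL2_advect ha hv.1))).mp hself] with x hx
  exact mul_self_eq_zero.mp hx

end H10Space

/-! ### Simplices and barycentric coordinates -/

theorem isCompact_simplex (K : Finset (Space d)) : IsCompact (simplex K) :=
  K.finite_toSet.isCompact_convexHull (𝕜 := ℝ)

theorem convex_simplex (K : Finset (Space d)) : Convex ℝ (simplex K) :=
  convex_convexHull ℝ _

theorem subset_simplex (K : Finset (Space d)) : (K : Set (Space d)) ⊆ simplex K :=
  subset_convexHull ℝ _

/-- `K` is the vertex set of a nondegenerate `d`-simplex. -/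
structure IsCell (K : Finset (Space d)) : Prop where
  card_eq : K.card = d + 1
  affineIndependent : AffineIndependent ℝ ((↑) : K → Space d)

/-- The affine basis of `ℝ^d` formed by the vertices of a nondegenerate simplex. -/
def IsCell.affineBasis {K : Finset (Space d)} (hK : IsCell K) : AffineBasis K ℝ (Space d) :=
  ⟨(↑), hK.affineIndependent,
    hK.affineIndependent.affineSpan_eq_top_iff_card_eq_finrank_add_one.mpr (by simp [hK.card_eq])⟩

open Classical in
/-- The barycentric coordinate of the vertex `v` of `K`. It is `0` if `v` is not a vertex of `K`,
so that the coordinates of a point of a face do not depend on the simplex. -/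
def bary (K : Finset (Space d)) (v : Space d) : Space d →ᵃ[ℝ] ℝ :=
  if h : IsCell K ∧ v ∈ K then h.1.affineBasis.coord ⟨v, h.2⟩ else 0

theorem bary_eq_zero {K : Finset (Space d)} {v : Space d} (hv : v ∉ K) : bary K v = 0 :=
  dif_neg fun h => hv h.2

namespace IsCell

variable {K : Finset (Space d)}

theorem affineBasis_apply (hK : IsCell K) (v : K) : hK.affineBasis v = v := rfl

theorem bary_eq_coord (hK : IsCell K) (v : K) : bary K v = hK.affineBasis.coord v := by
  rw [bary, dif_pos ⟨hK, v.2⟩]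

theorem sum_bary (hK : IsCell K) (x : Space d) : ∑ v ∈ K, bary K v x = 1 := by
  rw [← Finset.sum_coe_sort K (fun v => bary K v x)]
  simp only [hK.bary_eq_coord]
  exact hK.affineBasis.sum_coord_apply_eq_one x

theorem sum_bary_smul (hK : IsCell K) (x : Space d) : ∑ v ∈ K, bary K v x • v = x := by
  rw [← Finset.sum_coe_sort K (fun v => bary K v x • v)]
  simp only [hK.bary_eq_coord]
  exact hK.affineBasis.linear_combination_coord_eq_self x

theorem bary_nonneg (hK : IsCell K) {x : Space d} (hx : x ∈ simplex K) (v : Space d) :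
    0 ≤ bary K v x := by
  by_cases hv : v ∈ K
  · have hrange : range hK.affineBasis = (K : Set (Space d)) := Subtype.range_coe
    rw [simplex, ← hrange, hK.affineBasis.convexHull_eq_nonneg_coord] at hx
    simpa only [hK.bary_eq_coord ⟨v, hv⟩] using hx ⟨v, hv⟩
  · rw [bary_eq_zero hv]
    exact le_rfl

theorem bary_le_one (hK : IsCell K) {x : Space d} (hx : x ∈ simplex K) {v : Space d}
    (hv : v ∈ K) : bary K v x ≤ 1 := by
  rw [← hK.sum_bary x]
  exact Finset.single_le_sum (f := fun v => bary K v x) (fun y _ => hK.bary_nonneg hx y) hv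

theorem bary_sum_smul (hK : IsCell K) {w : Space d → ℝ} (hw : ∑ y ∈ K, w y = 1)
    {v : Space d} (hv : v ∈ K) : bary K v (∑ y ∈ K, w y • y) = w v := by
  have hw' : ∑ y : K, w y = 1 := by rw [← hw, Finset.sum_coe_sort K w]
  have h := hK.affineBasis.coord_apply_combination_of_mem
    (Finset.mem_univ (⟨v, hv⟩ : K)) (w := fun y : K => w y) hw'
  rw [Finset.affineCombination_eq_linear_combination _ _ _ hw'] at h
  simp only [affineBasis_apply] at h
  rwa [Finset.sum_coe_sort K (fun y => w y • y), ← hK.bary_eq_coord ⟨v, hv⟩] at h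

open Classical in
theorem bary_sum_smul_of_subset (hK : IsCell K) {F : Finset (Space d)} (hF : F ⊆ K)
    {w : Space d → ℝ} (hw : ∑ y ∈ F, w y = 1) (v : Space d) :
    bary K v (∑ y ∈ F, w y • y) = if v ∈ F then w v else 0 := by
  set w' : Space d → ℝ := fun y => if y ∈ F then w y else 0
  have hw' : ∑ y ∈ K, w' y = 1 := by
    rw [← hw, Finset.sum_ite_mem, Finset.inter_eq_right.mpr hF]
  have hsum : ∑ y ∈ F, w y • y = ∑ y ∈ K, w' y • y := by
    simp only [w', ite_smul, zero_smul, Finset.sum_ite_mem, Finset.inter_eq_right.mpr hF]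
  by_cases hv : v ∈ K
  · rw [hsum, hK.bary_sum_smul hw' hv]
  · rw [bary_eq_zero hv, if_neg fun h => hv (hF h)]
    rfl

end IsCell

/-! ### Triangulations -/

namespace Triangulation

section

variable (T : Triangulation Ω) {K L : Finset (Space d)}

theorem isCell (hK : K ∈ T.cells) : IsCell K :=
  ⟨T.card_cell K hK, T.indep K hK⟩

theorem diam_le_meshSize (hK : K ∈ T.cells) : Metric.diam (simplex K) ≤ T.meshSize :=
  le_ciSup (f := fun K : T.cells => Metric.diam (simplex (K : Finset (Space d))))
    (Set.finite_range _).bddAbove ⟨K, hK⟩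

theorem meshSize_nonneg : 0 ≤ T.meshSize :=
  Real.iSup_nonneg fun _ => Metric.diam_nonneg

theorem dist_le_meshSize (hK : K ∈ T.cells) {x y : Space d} (hx : x ∈ simplex K)
    (hy : y ∈ simplex K) : dist x y ≤ T.meshSize :=
  (Metric.dist_le_diam_of_mem (isCompact_simplex K).isBounded hx hy).trans (T.diam_le_meshSize hK)

theorem iUnion_simplex : ⋃ K : T.cells, simplex (K : Finset (Space d)) = closure Ω := by
  rw [← T.cover, iUnion_subtype]

theorem simplex_subset_closure (hK : K ∈ T.cells) : simplex K ⊆ closure Ω :=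
  T.iUnion_simplex ▸ subset_iUnion (fun K : T.cells => simplex (K : Finset (Space d))) ⟨K, hK⟩

theorem exists_mem_simplex {x : Space d} (hx : x ∈ closure Ω) : ∃ K ∈ T.cells, x ∈ simplex K := by
  simpa [← T.cover] using hx

theorem bary_eq_bary (hK : K ∈ T.cells) (hL : L ∈ T.cells) {x : Space d} (hxK : x ∈ simplex K)
    (hxL : x ∈ simplex L) (v : Space d) : bary K v x = bary L v x := by
  classical
  have hx : x ∈ convexHull ℝ ((K ∩ L : Finset (Space d)) : Set (Space d)) := by
    rw [Finset.coe_inter, ← T.conforming K hK L hL]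
    exact ⟨hxK, hxL⟩
  obtain ⟨w, -, hw, rfl⟩ := Finset.mem_convexHull'.mp hx
  rw [(T.isCell hK).bary_sum_smul_of_subset Finset.inter_subset_left hw,
    (T.isCell hL).bary_sum_smul_of_subset Finset.inter_subset_right hw]

theorem aedisjoint_simplex (hK : K ∈ T.cells) (hL : L ∈ T.cells) (hne : K ≠ L) :
    AEDisjoint volume (simplex K) (simplex L) := by
  obtain ⟨v, hvK, hvL⟩ : ∃ v ∈ K, v ∉ L := by
    by_contra! h
    exact hne (Finset.eq_of_subset_of_card_le h (by rw [T.card_cell K hK, T.card_cell L hL]))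
  set A : AffineSubspace ℝ (Space d) := affineSpan ℝ ((↑) '' (univ \ {(⟨v, hvK⟩ : K)} : Set K))
  have hv : v ∉ A := (T.indep K hK).notMem_affineSpan_sdiff ⟨v, hvK⟩ univ
  have hsub : simplex K ∩ simplex L ⊆ A := by
    rw [T.conforming K hK L hL]
    refine (convexHull_subset_affineSpan _).trans (affineSpan_mono ℝ ?_)
    rintro w ⟨hwK, hwL⟩
    refine ⟨⟨w, hwK⟩, ⟨mem_univ _, fun h => hvL ?_⟩, rfl⟩
    obtain rfl : w = v := congrArg Subtype.val h
    exact hwL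
  refine measure_mono_null hsub (Measure.addHaar_affineSubspace volume A fun htop => hv ?_)
  exact htop ▸ AffineSubspace.mem_top ℝ _ v

theorem ae_mem_interior_simplex : ∀ᵐ x ∂(volume.restrict (closure Ω)),
    ∃ K ∈ T.cells, x ∈ interior (simplex K) := by
  have hnull : volume (⋃ K ∈ T.cells, frontier (simplex K)) = 0 :=
    (measure_biUnion_null_iff T.cells.countable_toSet).mpr fun K _ =>
      (convex_simplex K).addHaar_frontier volume
  rw [ae_restrict_iff' isClosed_closure.measurableSet]
  filter_upwards [compl_mem_ae_iff.mpr hnull] with x hx hxc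
  obtain ⟨K, hK, hxK⟩ := T.exists_mem_simplex hxc
  exact ⟨K, hK, by_contra fun hxi => hx (mem_biUnion hK ⟨subset_closure hxK, hxi⟩)⟩

theorem closure_ae_eq (T : Triangulation Ω) (hΩr : interior (closure Ω) = Ω) :
    closure Ω =ᵐ[volume] Ω := by
  refine EventuallyLE.antisymm ?_ (Eventually.of_forall fun x hx => subset_closure hx)
  filter_upwards [(ae_restrict_iff' isClosed_closure.measurableSet).mp T.ae_mem_interior_simplex]
    with x hx hxc
  obtain ⟨K, hK, hxK⟩ := hx hxc
  exact hΩr ▸ interior_mono (T.simplex_subset_closure hK) hxK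

theorem ae_restrict_mem_interior_simplex (hΩr : interior (closure Ω) = Ω) :
    ∀ᵐ x ∂(volume.restrict Ω), ∃ K ∈ T.cells, x ∈ interior (simplex K) :=
  Measure.restrict_congr_set (T.closure_ae_eq hΩr) ▸ T.ae_mem_interior_simplex

theorem stab_const (hΩr : interior (closure Ω) = Ω) (τ : ℝ) {α β : Space d → ℝ}
    (hα : MemL2 Ω α) (hβ : MemL2 Ω β) :
    T.stab (fun _ => τ) α β = τ * ∫ x in Ω, α x * β x := by
  have hΩ : volume.restrict (⋃ K : T.cells, simplex (K : Finset (Space d))) =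
      volume.restrict Ω := by
    rw [T.iUnion_simplex, Measure.restrict_congr_set (T.closure_ae_eq hΩr)]
  have hint : IntegrableOn (fun x => α x * β x)
      (⋃ K : T.cells, simplex (K : Finset (Space d))) := by
    rw [IntegrableOn, hΩ]
    exact hα.integrable_mul hβ
  have h := integral_iUnion_ae (μ := volume)
    (fun K : T.cells => (isCompact_simplex (K : Finset (Space d))).measurableSet.nullMeasurableSet)
    (fun K L hne => T.aedisjoint_simplex K.2 L.2 fun h => hne (Subtype.ext h)) hint
  rw [hΩ, tsum_fintype] at h
  rw [stab, ← Finset.mul_sum, h, ← Finset.sum_coe_sort T.cells]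

/-- The function that agrees with `g K` on each cell `K`, for functions `g K` agreeing on the
intersections of the cells, extended by zero outside `closure Ω`. -/
def glue (g : Finset (Space d) → Space d → ℝ) (x : Space d) : ℝ :=
  open Classical in if h : ∃ K ∈ T.cells, x ∈ simplex K then g h.choose x else 0

variable {T} in
theorem glue_eq {g : Finset (Space d) → Space d → ℝ}
    (hg : ∀ K ∈ T.cells, ∀ L ∈ T.cells, ∀ x ∈ simplex K, x ∈ simplex L → g K x = g L x)
    (hK : K ∈ T.cells) {x : Space d} (hx : x ∈ simplex K) : T.glue g x = g K x := by
  have h : ∃ K ∈ T.cells, x ∈ simplex K := ⟨K, hK, hx⟩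
  rw [glue, dif_pos h]
  exact hg _ h.choose_spec.1 K hK x h.choose_spec.2 hx

theorem glue_eq_zero (g : Finset (Space d) → Space d → ℝ) {x : Space d} (hx : x ∉ closure Ω) :
    T.glue g x = 0 :=
  dif_neg fun ⟨_, hK, hxK⟩ => hx (T.simplex_subset_closure hK hxK)

end

end Triangulation

/-! ### Piecewise polynomial functions -/

namespace IsPolyOn

variable {k l : ℕ} {S S' : Set (Space d)} {f g : Space d → ℝ}

theorem const (l : ℕ) (S : Set (Space d)) (c : ℝ) : IsPolyOn l S (fun _ => c) :=
  ⟨MvPolynomial.C c, by simp, by simp⟩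

theorem congr (hf : IsPolyOn l S f) (h : EqOn g f S) : IsPolyOn l S g := by
  obtain ⟨p, hp, hpe⟩ := hf
  exact ⟨p, hp, fun x hx => (h hx).trans (hpe x hx)⟩

theorem mono (hf : IsPolyOn k S f) (hkl : k ≤ l) : IsPolyOn l S f := by
  obtain ⟨p, hp, hpe⟩ := hf
  exact ⟨p, hp.trans hkl, hpe⟩

theorem mul (hf : IsPolyOn k S f) (hg : IsPolyOn l S g) :
    IsPolyOn (k + l) S (fun x => f x * g x) := by
  obtain ⟨p, hp, hpe⟩ := hf
  obtain ⟨q, hq, hqe⟩ := hg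
  exact ⟨p * q, (MvPolynomial.totalDegree_mul p q).trans (add_le_add hp hq),
    fun x hx => by simp only [hpe x hx, hqe x hx, map_mul]⟩

theorem add (hf : IsPolyOn l S f) (hg : IsPolyOn l S g) : IsPolyOn l S (fun x => f x + g x) := by
  obtain ⟨p, hp, hpe⟩ := hf
  obtain ⟨q, hq, hqe⟩ := hg
  exact ⟨p + q, (MvPolynomial.totalDegree_add p q).trans (max_le hp hq),
    fun x hx => by simp only [hpe x hx, hqe x hx, map_add]⟩

theorem const_mul (hf : IsPolyOn l S f) (c : ℝ) : IsPolyOn l S (fun x => c * f x) := by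
  simpa only [zero_add] using (const 0 S c).mul hf

theorem sum {κ : Type*} (s : Finset κ) {f : κ → Space d → ℝ} (hf : ∀ k ∈ s, IsPolyOn l S (f k)) :
    IsPolyOn l S (fun x => ∑ k ∈ s, f k x) := by
  induction s using Finset.cons_induction with
  | empty => simpa using const l S 0
  | cons k s hk ih =>
    simp only [Finset.sum_cons]
    exact (hf k (Finset.mem_cons_self k s)).add
      (ih fun j hj => hf j (Finset.mem_cons_of_mem hj))

theorem prod {κ : Type*} (s : Finset κ) {n : κ → ℕ} {f : κ → Space d → ℝ}
    (hf : ∀ k ∈ s, IsPolyOn (n k) S (f k)) :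
    IsPolyOn (∑ k ∈ s, n k) S (fun x => ∏ k ∈ s, f k x) := by
  induction s using Finset.cons_induction with
  | empty => simpa using const 0 S 1
  | cons k s hk ih =>
    simp only [Finset.sum_cons, Finset.prod_cons]
    exact (hf k (Finset.mem_cons_self k s)).mul
      (ih fun j hj => hf j (Finset.mem_cons_of_mem hj))

theorem continuousOn (hf : IsPolyOn l S f) : ContinuousOn f S := by
  obtain ⟨p, -, hp⟩ := hf
  have hcont : Continuous fun x : Space d => MvPolynomial.eval (fun i => x i) p :=
    (MvPolynomial.continuous_eval p).comp (by fun_prop)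
  exact hcont.continuousOn.congr hp

end IsPolyOn

theorem affineMap_add_smul {E : Type*} [AddCommGroup E] [Module ℝ E] (A : E →ᵃ[ℝ] ℝ) (x e : E)
    (t : ℝ) : A (x + t • e) = A x + t * A.linear e := by
  rw [add_comm, ← vadd_eq_add, A.map_vadd, map_smul, vadd_eq_add, smul_eq_mul, add_comm]

theorem isPolyOn_affineMap (A : Space d →ᵃ[ℝ] ℝ) (S : Set (Space d)) : IsPolyOn 1 S A := by
  have hA : ∀ x, A x = A 0 + ∑ i, A.linear (EuclideanSpace.single i 1) * x i := by
    intro x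
    have hx : x = ∑ i, x i • (EuclideanSpace.single i (1 : ℝ) : Space d) := by
      ext j
      simp [Finset.sum_apply, Pi.single_apply]
    have hlin : A x = A 0 + A.linear x := by simpa using affineMap_add_smul A 0 x 1
    conv_lhs => rw [hlin, hx, map_sum]
    simp only [map_smul, smul_eq_mul, mul_comm]
  have hX : ∀ i, IsPolyOn 1 S (fun x : Space d => x i) := fun i =>
    ⟨MvPolynomial.X i, by simp, by simp⟩
  exact ((IsPolyOn.const 1 S (A 0)).add (IsPolyOn.sum _ fun i _ =>
    (hX i).const_mul (A.linear (EuclideanSpace.single i 1)))).congr fun x _ => hA x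

namespace Triangulation

variable (T : Triangulation Ω)

theorem continuousOn_of_isPolyOn {v : Space d → ℝ} {l : ℕ}
    (hv : ∀ K ∈ T.cells, IsPolyOn l (simplex K) v) : ContinuousOn v (closure Ω) := by
  rw [← T.iUnion_simplex]
  exact (locallyFinite_of_finite _).continuousOn_iUnion
    (fun K => (isCompact_simplex (K : Finset (Space d))).isClosed) fun K => (hv K K.2).continuousOn

theorem glue_mem_lagrangeSpace {g : Finset (Space d) → Space d → ℝ}
    (hg : ∀ K ∈ T.cells, ∀ L ∈ T.cells, ∀ x ∈ simplex K, x ∈ simplex L → g K x = g L x) {l : ℕ}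
    (hp : ∀ K ∈ T.cells, IsPolyOn l (simplex K) (g K)) : T.glue g ∈ T.lagrangeSpace l := by
  have hpoly : ∀ K ∈ T.cells, IsPolyOn l (simplex K) (T.glue g) := fun K hK =>
    (hp K hK).congr fun x hx => glue_eq hg hK hx
  exact ⟨T.continuousOn_of_isPolyOn hpoly, hpoly, fun x hx => T.glue_eq_zero g hx⟩

/-- The Lagrange finite element space `V_h^{(l)}` as a linear subspace of the space of all
functions. -/
def lagrangeSubmodule (l : ℕ) : Submodule ℝ (Space d → ℝ) where
  carrier := T.lagrangeSpace l
  add_mem' := fun ⟨hv₁, hv₂, hv₃⟩ ⟨hw₁, hw₂, hw₃⟩ =>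
    ⟨hv₁.add hw₁, fun K hK => (hv₂ K hK).add (hw₂ K hK),
      fun x hx => by simp [hv₃ x hx, hw₃ x hx]⟩
  zero_mem' := ⟨continuousOn_const, fun _ _ => IsPolyOn.const _ _ 0, fun _ _ => rfl⟩
  smul_mem' := fun c _ ⟨hv₁, hv₂, hv₃⟩ =>
    ⟨hv₁.const_smul c, fun K hK => (hv₂ K hK).const_mul c, fun x hx => by simp [hv₃ x hx]⟩

end Triangulation

/-! ### Lagrange interpolation -/

theorem real_choose_eq_prod (t : ℝ) (n : ℕ) :
    Ring.choose t n = (n.factorial : ℝ)⁻¹ * ∏ j ∈ Finset.range n, (t - j) := by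
  rw [Ring.choose_eq_smul, smul_eq_mul, ← Polynomial.aeval_eq_smeval, Polynomial.aeval_def,
    Polynomial.eval₂_eq_eval_map, descPochhammer_map, descPochhammer_eval_eq_prod_range]

theorem abs_real_choose_le {l n : ℕ} (hn : n ≤ l) {t : ℝ} (ht₀ : 0 ≤ t) (ht : t ≤ l) :
    |Ring.choose t n| ≤ (l : ℝ) ^ n := by
  have hfactor : ∀ j ∈ Finset.range n, |t - j| ≤ l := by
    intro j hj
    have hjl : (j : ℝ) ≤ l := by exact_mod_cast (Finset.mem_range.mp hj).le.trans hn
    rw [abs_le]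
    constructor <;> linarith [(j.cast_nonneg : (0 : ℝ) ≤ j)]
  rw [real_choose_eq_prod, abs_mul, Finset.abs_prod, abs_of_nonneg (by positivity)]
  calc (n.factorial : ℝ)⁻¹ * ∏ j ∈ Finset.range n, |t - j| ≤ 1 * (l : ℝ) ^ n := by
        gcongr
        · exact inv_le_one_of_one_le₀ (mod_cast n.factorial_pos)
        · simpa using Finset.prod_le_prod (fun j _ => abs_nonneg _) hfactor
    _ = (l : ℝ) ^ n := one_mul _

theorem isPolyOn_choose (A : Space d →ᵃ[ℝ] ℝ) (n : ℕ) (S : Set (Space d)) :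
    IsPolyOn n S (fun x => Ring.choose (A x) n) := by
  have hfactor : ∀ j ∈ Finset.range n, IsPolyOn 1 S (fun x => A x - j) := fun j _ => by
    simpa only [sub_eq_add_neg] using (isPolyOn_affineMap A S).add (IsPolyOn.const 1 S (-j))
  have h := (IsPolyOn.prod (Finset.range n) hfactor).const_mul (n.factorial : ℝ)⁻¹
  simp only [Finset.sum_const, Finset.card_range, smul_eq_mul, mul_one] at h
  exact h.congr fun x _ => real_choose_eq_prod _ _

/-- The multi-indices of degree `l` on the vertices of `K`, which index the Lagrange nodes. -/
def multiIndices (l : ℕ) (K : Finset (Space d)) : Finset (Space d → ℕ) :=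
  open Classical in Finset.piAntidiag K l

/-- The Lagrange node of multi-index `m`. -/
def node (l : ℕ) (K : Finset (Space d)) (m : Space d → ℕ) : Space d :=
  ∑ v ∈ K, ((m v : ℝ) / (l : ℝ)) • v

/-- The Lagrange basis function of multi-index `m`: a product over the vertices `v` of generalised
binomial coefficients `(l λ_v choose m_v)` in the barycentric coordinates `λ_v`. -/
def lagrangeBasis (l : ℕ) (K : Finset (Space d)) (m : Space d → ℕ) (x : Space d) : ℝ :=
  ∏ v ∈ K, Ring.choose (l * bary K v x) (m v)

/-- The polynomial with the value `c m` at the Lagrange node of multi-index `m`. -/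
def localInterp (l : ℕ) (K : Finset (Space d)) (c : (Space d → ℕ) → ℝ) (x : Space d) : ℝ :=
  ∑ m ∈ multiIndices l K, c m * lagrangeBasis l K m x

section

variable {l : ℕ} {K F : Finset (Space d)} {m k : Space d → ℕ}

theorem mem_multiIndices : m ∈ multiIndices l K ↔ ∑ v ∈ K, m v = l ∧ ∀ v, m v ≠ 0 → v ∈ K :=
  Finset.mem_piAntidiag

theorem eq_zero_of_mem_multiIndices (hm : m ∈ multiIndices l K) {v : Space d} (hv : v ∉ K) :
    m v = 0 :=
  not_imp_comm.mp ((mem_multiIndices.mp hm).2 v) hv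

theorem le_of_mem_multiIndices (hm : m ∈ multiIndices l K) {v : Space d} (hv : v ∈ K) :
    m v ≤ l :=
  (mem_multiIndices.mp hm).1 ▸ Finset.single_le_sum (fun _ _ => Nat.zero_le _) hv

theorem mem_multiIndices_of_subset (hF : F ⊆ K) :
    m ∈ multiIndices l F ↔ m ∈ multiIndices l K ∧ ∀ v ∈ K, v ∉ F → m v = 0 := by
  constructor
  · refine fun hm => ⟨mem_multiIndices.mpr ⟨?_, fun v hv => ?_⟩, fun v _ hv => ?_⟩
    · rw [← (mem_multiIndices.mp hm).1]
      exact (Finset.sum_subset hF fun v _ hv => eq_zero_of_mem_multiIndices hm hv).symm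
    · exact hF ((mem_multiIndices.mp hm).2 v hv)
    · exact eq_zero_of_mem_multiIndices hm hv
  · rintro ⟨hm, hmF⟩
    refine mem_multiIndices.mpr ⟨?_, fun v hv => ?_⟩
    · rw [← (mem_multiIndices.mp hm).1]
      exact Finset.sum_subset hF hmF
    · exact by_contra fun hvF => hv (hmF v ((mem_multiIndices.mp hm).2 v hv) hvF)

theorem card_multiIndices (l : ℕ) (K : Finset (Space d)) :
    (multiIndices l K).card = Nat.multichoose K.card l := by
  classical
  rw [← Finset.card_finsuppAntidiag_nat_eq_multichoose, Finset.finsuppAntidiag,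
    Finset.card_map, Finset.card_attach]
  rfl

theorem sum_div_eq_one (hl : l ≠ 0) (hm : m ∈ multiIndices l K) :
    ∑ v ∈ K, (m v : ℝ) / (l : ℝ) = 1 := by
  rw [← Finset.sum_div, ← Nat.cast_sum, (mem_multiIndices.mp hm).1,
    div_self (Nat.cast_ne_zero.mpr hl)]

theorem lagrangeNodes_eq_image (l : ℕ) (K : Finset (Space d)) :
    lagrangeNodes l K = node l K '' multiIndices l K := by
  classical
  refine Subset.antisymm ?_ ?_
  · rintro x ⟨m, hm, rfl⟩
    refine ⟨fun v => if v ∈ K then m v else 0, mem_multiIndices.mpr ⟨?_, fun v hv => ?_⟩, ?_⟩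
    · rw [← hm]
      exact Finset.sum_congr rfl fun v hv => if_pos hv
    · exact by_contra fun h => hv (if_neg h)
    · exact Finset.sum_congr rfl fun v hv => by simp only [if_pos hv]
  · rintro _ ⟨m, hm, rfl⟩
    exact ⟨m, (mem_multiIndices.mp hm).1, rfl⟩

theorem node_mem_simplex (hl : l ≠ 0) (hm : m ∈ multiIndices l K) : node l K m ∈ simplex K :=
  (convex_simplex K).sum_mem (fun _ _ => by positivity) (sum_div_eq_one hl hm)
    fun _ hv => subset_simplex K hv

theorem isPolyOn_localInterp (l : ℕ) (K : Finset (Space d)) (c : (Space d → ℕ) → ℝ)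
    (S : Set (Space d)) : IsPolyOn l S (localInterp l K c) := by
  refine IsPolyOn.sum _ fun m hm => ?_
  have h := IsPolyOn.prod K (n := m) fun v _ => isPolyOn_choose ((l : ℝ) • bary K v) (m v) S
  rw [(mem_multiIndices.mp hm).1] at h
  exact h.const_mul (c m)

theorem localInterp_eq_sum_of_subset (hF : F ⊆ K) (u : Space d → ℝ) {x : Space d}
    (hx : ∀ v ∈ K, v ∉ F → bary K v x = 0) :
    localInterp l K (fun m => u (node l K m)) x =
      ∑ m ∈ multiIndices l F, u (node l F m) * ∏ v ∈ F, Ring.choose (l * bary K v x) (m v) := by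
  have hsub : multiIndices l F ⊆ multiIndices l K := fun m hm =>
    ((mem_multiIndices_of_subset hF).mp hm).1
  refine (Finset.sum_subset hsub fun m hmK hmF => ?_).symm.trans
    (Finset.sum_congr rfl fun m hm => ?_)
  · obtain ⟨v, hvK, hvF, hmv⟩ : ∃ v ∈ K, v ∉ F ∧ m v ≠ 0 := by
      by_contra! h
      exact hmF ((mem_multiIndices_of_subset hF).mpr ⟨hmK, h⟩)
    rw [lagrangeBasis, Finset.prod_eq_zero hvK, mul_zero]
    rw [hx v hvK hvF, mul_zero, Ring.choose_zero_pos ℝ (Nat.pos_of_ne_zero hmv)]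
  · have hm₀ : ∀ v ∈ K, v ∉ F → m v = 0 := fun v _ => eq_zero_of_mem_multiIndices hm
    have hnode : node l K m = node l F m :=
      (Finset.sum_subset hF fun v hvK hv => by simp [hm₀ v hvK hv]).symm
    simp only [hnode]
    rw [lagrangeBasis, ← Finset.prod_subset hF fun v hvK hv => by
      rw [hm₀ v hvK hv, Ring.choose_zero_right]]

end

namespace IsCell

variable {l : ℕ} {K : Finset (Space d)} {m k : Space d → ℕ}

theorem mul_bary_node (hK : IsCell K) (hl : l ≠ 0) (hm : m ∈ multiIndices l K) {v : Space d}
    (hv : v ∈ K) : l * bary K v (node l K m) = m v := by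
  rw [node, hK.bary_sum_smul (w := fun v => (m v : ℝ) / l) (sum_div_eq_one hl hm) hv,
    mul_div_cancel₀ _ (Nat.cast_ne_zero.mpr hl)]

theorem lagrangeBasis_node_self (hK : IsCell K) (hl : l ≠ 0) (hm : m ∈ multiIndices l K) :
    lagrangeBasis l K m (node l K m) = 1 :=
  Finset.prod_eq_one fun v hv => by
    rw [hK.mul_bary_node hl hm hv, Ring.choose_natCast, Nat.choose_self, Nat.cast_one]

theorem lagrangeBasis_node_of_ne (hK : IsCell K) (hl : l ≠ 0) (hm : m ∈ multiIndices l K)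
    (hk : k ∈ multiIndices l K) (hne : m ≠ k) : lagrangeBasis l K m (node l K k) = 0 := by
  obtain ⟨v, hv, hlt⟩ : ∃ v ∈ K, k v < m v := by
    by_contra! hle
    have heq := (Finset.sum_eq_sum_iff_of_le hle).mp
      ((mem_multiIndices.mp hm).1.trans (mem_multiIndices.mp hk).1.symm)
    refine hne (funext fun v => ?_)
    by_cases hv : v ∈ K
    · exact heq v hv
    · rw [eq_zero_of_mem_multiIndices hm hv, eq_zero_of_mem_multiIndices hk hv]
  refine Finset.prod_eq_zero hv ?_
  rw [hK.mul_bary_node hl hk hv, Ring.choose_natCast, Nat.choose_eq_zero_of_lt hlt, Nat.cast_zero]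

theorem localInterp_node (hK : IsCell K) (hl : l ≠ 0) (c : (Space d → ℕ) → ℝ)
    (hk : k ∈ multiIndices l K) : localInterp l K c (node l K k) = c k := by
  rw [localInterp, Finset.sum_eq_single_of_mem k hk, hK.lagrangeBasis_node_self hl hk, mul_one]
  intro m hm hne
  rw [hK.lagrangeBasis_node_of_ne hl hm hk hne, mul_zero]

theorem abs_lagrangeBasis_le (hK : IsCell K) (hm : m ∈ multiIndices l K) {x : Space d}
    (hx : x ∈ simplex K) : |lagrangeBasis l K m x| ≤ (l : ℝ) ^ l := by
  rw [lagrangeBasis, Finset.abs_prod]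
  calc ∏ v ∈ K, |Ring.choose (l * bary K v x) (m v)| ≤ ∏ v ∈ K, (l : ℝ) ^ m v := by
        refine Finset.prod_le_prod (fun v _ => abs_nonneg _) fun v hv => ?_
        exact abs_real_choose_le (le_of_mem_multiIndices hm hv)
          (mul_nonneg l.cast_nonneg (hK.bary_nonneg hx v))
          (mul_le_of_le_one_right l.cast_nonneg (hK.bary_le_one hx hv))
    _ = (l : ℝ) ^ l := by rw [Finset.prod_pow_eq_pow_sum, (mem_multiIndices.mp hm).1]

/-- Homogenisation: a monomial of degree at most `l` in `d` variables extends uniquely to one of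
degree `l` in `d + 1` variables, and `K` has `d + 1` vertices. -/
theorem finrank_restrictTotalDegree_le (hK : IsCell K) (l : ℕ) :
    Module.finrank ℝ (MvPolynomial.restrictTotalDegree (Fin d) ℝ l) ≤
      (multiIndices l K).card := by
  classical
  let e : K ≃ Fin (d + 1) := K.equivFinOfCardEq hK.card_eq
  let S : Set (Fin d →₀ ℕ) := {s | (s.sum fun _ k => k) ≤ l}
  let exponent (s : Fin d →₀ ℕ) : Fin (d + 1) → ℕ := Fin.cons (l - ∑ i, s i) s
  let homogenise (s : Fin d →₀ ℕ) (v : Space d) : ℕ :=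
    if h : v ∈ K then exponent s (e ⟨v, h⟩) else 0
  have hmem : ∀ s : S, homogenise s ∈ multiIndices l K := by
    rintro ⟨s, hs⟩
    have hsum : ∑ i, s i ≤ l := (Finsupp.sum_fintype s (fun _ k => k) fun _ => rfl).symm.trans_le hs
    refine mem_multiIndices.mpr ⟨?_, fun v hv => by_contra fun h => hv (dif_neg h)⟩
    rw [← Finset.sum_coe_sort K]
    simp only [homogenise, Finset.coe_mem, dite_true, Subtype.coe_eta]
    rw [Equiv.sum_comp e (exponent s), Fin.sum_univ_succ]
    simp only [exponent, Fin.cons_zero, Fin.cons_succ]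
    omega
  have hinj : Function.Injective fun s : S => (⟨homogenise s, hmem s⟩ : multiIndices l K) := by
    refine fun s t hst => Subtype.ext (Finsupp.ext fun i => ?_)
    simpa [homogenise, exponent] using
      congrFun (congrArg Subtype.val hst) (e.symm i.succ : Space d)
  have : Finite S := Finite.of_injective _ hinj
  have hcard := Nat.card_le_card_of_injective _ hinj
  rw [Nat.card_eq_fintype_card (α := multiIndices l K), Fintype.card_coe] at hcard
  exact (Module.finrank_eq_nat_card_basis (MvPolynomial.basisRestrictSupport ℝ S)).trans_le hcard

/-- Evaluation at the nodes is surjective, by the Lagrange basis, and hence bijective, by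
dimension count. -/
theorem eq_of_eval_node_eq (hK : IsCell K) (hl : l ≠ 0) {p q : MvPolynomial (Fin d) ℝ}
    (hp : p.totalDegree ≤ l) (hq : q.totalDegree ≤ l)
    (hpq : ∀ m ∈ multiIndices l K, MvPolynomial.eval (fun i => node l K m i) p =
      MvPolynomial.eval (fun i => node l K m i) q) : p = q := by
  classical
  let nodalValues : MvPolynomial.restrictTotalDegree (Fin d) ℝ l →ₗ[ℝ] (multiIndices l K → ℝ) :=
    (LinearMap.pi fun m : multiIndices l K =>
      (MvPolynomial.aeval fun i => node l K m i).toLinearMap).comp (Submodule.subtype _)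
  have hsurj : Function.Surjective nodalValues := by
    intro y
    obtain ⟨r, hr, hre⟩ := isPolyOn_localInterp l K
      (fun m => if h : m ∈ multiIndices l K then y ⟨m, h⟩ else 0) univ
    refine ⟨⟨r, (MvPolynomial.mem_restrictTotalDegree _ _ _).mpr hr⟩, funext fun m => ?_⟩
    refine (hre (node l K m) (mem_univ _)).symm.trans ?_
    rw [hK.localInterp_node hl _ m.2, dif_pos m.2]
  have hinj : Function.Injective nodalValues := by
    refine (LinearMap.injective_iff_surjective_of_finrank_eq_finrank (le_antisymm ?_ ?_)).mpr hsurj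
    · rw [Module.finrank_fintype_fun_eq_card, Fintype.card_coe]
      exact hK.finrank_restrictTotalDegree_le l
    · exact LinearMap.finrank_le_finrank_of_surjective hsurj
  have h : (⟨p, (MvPolynomial.mem_restrictTotalDegree _ _ _).mpr hp⟩ :
      MvPolynomial.restrictTotalDegree (Fin d) ℝ l) =
      ⟨q, (MvPolynomial.mem_restrictTotalDegree _ _ _).mpr hq⟩ :=
    hinj (funext fun m => hpq m m.2)
  exact congrArg Subtype.val h

theorem eq_localInterp (hK : IsCell K) (hl : l ≠ 0) {f : Space d → ℝ}
    (hf : IsPolyOn l (simplex K) f) {x : Space d} (hx : x ∈ simplex K) :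
    f x = localInterp l K (fun m => f (node l K m)) x := by
  obtain ⟨p, hp, hpe⟩ := hf
  obtain ⟨q, hq, hqe⟩ := isPolyOn_localInterp l K (fun m => f (node l K m)) (simplex K)
  have hpq : p = q := hK.eq_of_eval_node_eq hl hp hq fun m hm => by
    have hmem := node_mem_simplex hl hm
    rw [← hpe _ hmem, ← hqe _ hmem, hK.localInterp_node hl _ hm]
  rw [hpe x hx, hqe x hx, hpq]

theorem abs_sub_le_of_lagrangeNodes (hK : IsCell K) (hl : l ≠ 0) {f : Space d → ℝ}
    (hf : IsPolyOn l (simplex K) f) {c ε : ℝ}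
    (hc : ∀ x ∈ lagrangeNodes l K, |f x - c| ≤ ε) {x : Space d} (hx : x ∈ simplex K) :
    |f x - c| ≤ Nat.multichoose (d + 1) l * (l : ℝ) ^ l * ε := by
  have hsub : IsPolyOn l (simplex K) (fun y => f y - c) := by
    simpa only [sub_eq_add_neg] using hf.add (IsPolyOn.const l _ (-c))
  rw [hK.eq_localInterp hl hsub hx]
  calc |localInterp l K (fun m => f (node l K m) - c) x|
      ≤ ∑ m ∈ multiIndices l K, |(f (node l K m) - c) * lagrangeBasis l K m x| :=
        Finset.abs_sum_le_sum_abs _ _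
    _ ≤ ∑ _m ∈ multiIndices l K, (l : ℝ) ^ l * ε := by
        refine Finset.sum_le_sum fun m hm => ?_
        have hnode : node l K m ∈ lagrangeNodes l K :=
          lagrangeNodes_eq_image l K ▸ mem_image_of_mem _ hm
        rw [abs_mul, mul_comm]
        exact mul_le_mul (hK.abs_lagrangeBasis_le hm hx) (hc _ hnode) (abs_nonneg _)
          (by positivity)
    _ = Nat.multichoose (d + 1) l * (l : ℝ) ^ l * ε := by
        rw [Finset.sum_const, card_multiIndices, hK.card_eq, nsmul_eq_mul, mul_assoc]

end IsCell

theorem finite_lagrangeNodes (l : ℕ) (K : Finset (Space d)) : (lagrangeNodes l K).Finite :=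
  lagrangeNodes_eq_image l K ▸ (multiIndices l K).finite_toSet.image _

theorem lagrangeNodes_subset_simplex {l : ℕ} (hl : l ≠ 0) (K : Finset (Space d)) :
    lagrangeNodes l K ⊆ simplex K := by
  rw [lagrangeNodes_eq_image]
  rintro _ ⟨m, hm, rfl⟩
  exact node_mem_simplex hl hm

namespace Triangulation

variable (T : Triangulation Ω) {l : ℕ}

theorem finiteDimensional_lagrangeSubmodule (hl : l ≠ 0) :
    FiniteDimensional ℝ (T.lagrangeSubmodule l) := by
  let nodes : Set (Space d) := ⋃ K ∈ T.cells, lagrangeNodes l K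
  have : Finite nodes := T.cells.finite_toSet.biUnion fun K _ => finite_lagrangeNodes l K
  let nodalValues : T.lagrangeSubmodule l →ₗ[ℝ] (nodes → ℝ) :=
    (LinearMap.funLeft ℝ ℝ ((↑) : nodes → Space d)).comp (Submodule.subtype _)
  refine FiniteDimensional.of_injective nodalValues
    ((injective_iff_map_eq_zero nodalValues).mpr fun v hv => Subtype.ext (funext fun x => ?_))
  by_cases hx : x ∈ closure Ω
  · obtain ⟨K, hK, hxK⟩ := T.exists_mem_simplex hx
    have h := (T.isCell hK).abs_sub_le_of_lagrangeNodes hl (v.2.2.1 K hK) (c := 0) (ε := 0)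
      (fun y hy => ?_) hxK
    · simpa using h
    · have hvy : (v : Space d → ℝ) y = 0 := congrFun hv ⟨y, mem_biUnion hK hy⟩
      simp [hvy]
  · exact v.2.2.2 x hx

theorem localInterp_eq_localInterp (l : ℕ) (u : Space d → ℝ) {K L : Finset (Space d)}
    (hK : K ∈ T.cells) (hL : L ∈ T.cells) {x : Space d} (hxK : x ∈ simplex K)
    (hxL : x ∈ simplex L) : localInterp l K (fun m => u (node l K m)) x =
      localInterp l L (fun m => u (node l L m)) x := by
  classical
  have hbary := T.bary_eq_bary hK hL hxK hxL
  rw [localInterp_eq_sum_of_subset (F := K ∩ L) Finset.inter_subset_left u fun v hvK hv => ?_,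
    localInterp_eq_sum_of_subset (F := K ∩ L) Finset.inter_subset_right u fun v hvL hv => ?_]
  · simp only [hbary]
  · rw [← hbary, bary_eq_zero fun hvK => hv (Finset.mem_inter.mpr ⟨hvK, hvL⟩)]
    rfl
  · rw [hbary, bary_eq_zero fun hvL => hv (Finset.mem_inter.mpr ⟨hvK, hvL⟩)]
    rfl

theorem isInterpolant_interpolate (hl : l ≠ 0) (u : Space d → ℝ) :
    T.IsInterpolant l u (T.interpolate l u) := by
  have hcompat : ∀ K ∈ T.cells, ∀ L ∈ T.cells, ∀ x ∈ simplex K, x ∈ simplex L →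
      localInterp l K (fun m => u (node l K m)) x = localInterp l L (fun m => u (node l L m)) x :=
    fun K hK L hL x hxK hxL => T.localInterp_eq_localInterp l u hK hL hxK hxL
  have hex : ∃ p, T.IsInterpolant l u p := by
    refine ⟨T.glue fun K => localInterp l K (fun m => u (node l K m)),
      T.glue_mem_lagrangeSpace hcompat fun K _ => isPolyOn_localInterp _ _ _ _, fun K hK => ?_⟩
    rw [lagrangeNodes_eq_image]
    rintro _ ⟨m, hm, rfl⟩
    rw [glue_eq hcompat hK (node_mem_simplex hl hm), (T.isCell hK).localInterp_node hl _ hm]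
  rw [interpolate, dif_pos hex]
  exact hex.choose_spec

theorem abs_interpolate_sub_le (hl : l ≠ 0) {u : Space d → ℝ} {ε : ℝ}
    (hu : ∀ x ∈ closure Ω, ∀ y ∈ closure Ω, dist x y ≤ T.meshSize → |u x - u y| ≤ ε)
    {x : Space d} (hx : x ∈ closure Ω) :
    |T.interpolate l u x - u x| ≤ Nat.multichoose (d + 1) l * (l : ℝ) ^ l * ε := by
  obtain ⟨K, hK, hxK⟩ := T.exists_mem_simplex hx
  have hI := T.isInterpolant_interpolate hl u
  refine (T.isCell hK).abs_sub_le_of_lagrangeNodes hl (hI.1.2.1 K hK) (fun y hy => ?_) hxK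
  have hyK := lagrangeNodes_subset_simplex hl K hy
  rw [hI.2 K hK y hy]
  exact hu y (T.simplex_subset_closure hK hyK) x hx (T.dist_le_meshSize hK hyK hxK)

end Triangulation

theorem tendstoUniformlyOn_interpolate (hΩb : Bornology.IsBounded Ω) {l : ℕ} (hl : l ≠ 0)
    {u : Space d → ℝ} (hu : ContinuousOn u (closure Ω)) {ι : Type*} {F : Filter ι}
    {T : ι → Triangulation Ω} (hT : Tendsto (fun i => (T i).meshSize) F (𝓝 0)) :
    TendstoUniformlyOn (fun i => (T i).interpolate l u) u F (closure Ω) := by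
  rw [Metric.tendstoUniformlyOn_iff]
  intro ε hε
  set C : ℝ := Nat.multichoose (d + 1) l * (l : ℝ) ^ l
  have : 0 ≤ C := by positivity
  obtain ⟨δ, hδ, hu⟩ := Metric.uniformContinuousOn_iff.mp
    (hΩb.isCompact_closure.uniformContinuousOn_of_continuous hu) (ε / (C + 1)) (by positivity)
  filter_upwards [hT.eventually_lt_const hδ] with i hi x hx
  rw [dist_comm, Real.dist_eq]
  calc |(T i).interpolate l u x - u x| ≤ C * (ε / (C + 1)) :=
        (T i).abs_interpolate_sub_le hl
          (fun y hy z hz hyz => (hu y hy z hz (hyz.trans_lt hi)).le) hx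
    _ = ε * (C / (C + 1)) := by ring
    _ < ε * 1 := by
        gcongr
        exact (div_lt_one (by positivity)).mpr (lt_add_one C)
    _ = ε := mul_one ε

/-! ### Density of the finite element spaces -/

theorem exists_norm_sub_sub_fderiv_le {E E' : Type*} [NormedAddCommGroup E] [NormedSpace ℝ E]
    [NormedAddCommGroup E'] [NormedSpace ℝ E'] {φ : E → E'} (hφ : ContDiff ℝ 2 φ)
    (hφc : HasCompactSupport φ) :
    ∃ M ≥ 0, ∀ x y, ‖φ y - φ x - fderiv ℝ φ x (y - x)‖ ≤ M * ‖y - x‖ ^ 2 := by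
  obtain ⟨M, hM⟩ := (hφ.fderiv_right (m := 1) le_rfl).lipschitzWith_of_hasCompactSupport
    (hφc.fderiv ℝ) one_ne_zero
  refine ⟨M, M.2, fun x y => ?_⟩
  have hderiv : ∀ z ∈ Metric.closedBall x ‖y - x‖,
      ‖fderiv ℝ φ z - fderiv ℝ φ x‖ ≤ M * ‖y - x‖ := fun z hz => by
    rw [← dist_eq_norm]
    exact (hM.dist_le_mul z x).trans (by gcongr; exact hz)
  rw [sq, ← mul_assoc]
  exact (convex_closedBall x ‖y - x‖).norm_image_sub_le_of_norm_fderiv_le'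
    (fun z _ => hφ.differentiable two_ne_zero z) hderiv
    (Metric.mem_closedBall_self (norm_nonneg _)) (by simp [dist_eq_norm])

theorem mul_abs_linear_le_of_closedBall {E : Type*} [NormedAddCommGroup E] [NormedSpace ℝ E]
    (A : E →ᵃ[ℝ] ℝ) {c : E} {r ε : ℝ} (hr : 0 ≤ r)
    (hA : ∀ x ∈ Metric.closedBall c r, |A x| ≤ ε) {e : E} (he : ‖e‖ ≤ 1) :
    r * |A.linear e| ≤ ε := by
  have hre : ∀ t, |t| ≤ r → c + t • e ∈ Metric.closedBall c r := fun t ht => by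
    rw [Metric.mem_closedBall, dist_self_add_left, norm_smul, Real.norm_eq_abs]
    exact (mul_le_of_le_one_right (abs_nonneg t) he).trans ht
  have hpos := hA _ (hre r (abs_of_nonneg hr).le)
  have hneg := hA _ (hre (-r) (by rw [abs_neg, abs_of_nonneg hr]))
  rw [affineMap_add_smul, abs_le] at hpos hneg
  rw [← abs_of_nonneg hr, ← abs_mul, abs_le]
  constructor <;> linarith [hpos.1, hpos.2, hneg.1, hneg.2]

/-- The first-order Taylor polynomial of `φ` at `x`. -/
def affineTaylor {E : Type*} [NormedAddCommGroup E] [NormedSpace ℝ E] (φ : E → ℝ) (x : E) :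
    E →ᵃ[ℝ] ℝ :=
  (fderiv ℝ φ x : E →ₗ[ℝ] ℝ).toAffineMap + AffineMap.const ℝ E (φ x - fderiv ℝ φ x x)

section affineTaylor

variable {E : Type*} [NormedAddCommGroup E] [NormedSpace ℝ E] (φ : E → ℝ) (x y : E)

theorem affineTaylor_apply : affineTaylor φ x y = φ x + fderiv ℝ φ x (y - x) := by
  rw [map_sub]
  exact add_sub_left_comm _ _ _

theorem affineTaylor_linear : (affineTaylor φ x).linear y = fderiv ℝ φ x y :=
  add_zero _

end affineTaylor

/-- The affine function with the values of `φ` at the vertices of the simplex `K`. -/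
def affineInterp (φ : Space d → ℝ) (K : Finset (Space d)) : Space d →ᵃ[ℝ] ℝ :=
  ∑ v ∈ K, φ v • bary K v

theorem affineInterp_apply (φ : Space d → ℝ) (K : Finset (Space d)) (x : Space d) :
    affineInterp φ K x = ∑ v ∈ K, φ v * bary K v x := by
  have h : ∀ s : Finset (Space d),
      (∑ v ∈ s, φ v • bary K v) x = ∑ v ∈ s, φ v * bary K v x := fun s => by
    induction s using Finset.cons_induction with
    | empty => rfl
    | cons v s hv ih =>
      rw [Finset.sum_cons, Finset.sum_cons, ← ih]
      rfl
  exact h K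

namespace IsCell

variable {K : Finset (Space d)} {φ : Space d → ℝ}

theorem affineMap_eq_sum (hK : IsCell K) (A : Space d →ᵃ[ℝ] ℝ) (x : Space d) :
    A x = ∑ v ∈ K, A v * bary K v x := by
  have hA : ∀ y, A y = A 0 + A.linear y := fun y => by simpa using affineMap_add_smul A 0 y 1
  calc A x = A 0 * ∑ v ∈ K, bary K v x + A.linear (∑ v ∈ K, bary K v x • v) := by
        rw [hK.sum_bary, hK.sum_bary_smul, mul_one, ← hA]
    _ = ∑ v ∈ K, (A 0 + A.linear v) * bary K v x := by
        rw [map_sum, Finset.mul_sum, ← Finset.sum_add_distrib]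
        refine Finset.sum_congr rfl fun v _ => ?_
        rw [map_smul, smul_eq_mul]
        ring
    _ = ∑ v ∈ K, A v * bary K v x := by simp only [← hA]

theorem abs_affineInterp_sub_le (hK : IsCell K) (A : Space d →ᵃ[ℝ] ℝ) {ε : ℝ}
    (hA : ∀ v ∈ K, |φ v - A v| ≤ ε) {x : Space d} (hx : x ∈ simplex K) :
    |affineInterp φ K x - A x| ≤ ε := by
  rw [affineInterp_apply, hK.affineMap_eq_sum A, ← Finset.sum_sub_distrib]
  calc |∑ v ∈ K, (φ v * bary K v x - A v * bary K v x)|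
      ≤ ∑ v ∈ K, |φ v * bary K v x - A v * bary K v x| := Finset.abs_sum_le_sum_abs _ _
    _ ≤ ∑ v ∈ K, ε * bary K v x := by
        refine Finset.sum_le_sum fun v hv => ?_
        rw [← sub_mul, abs_mul, abs_of_nonneg (hK.bary_nonneg hx v)]
        exact mul_le_mul_of_nonneg_right (hA v hv) (hK.bary_nonneg hx v)
    _ = ε := by rw [← Finset.mul_sum, hK.sum_bary, mul_one]

theorem abs_affineInterp_sub_affineTaylor_le (hK : IsCell K) {M : ℝ} (hM : 0 ≤ M)
    (hφ : ∀ x y, |φ y - φ x - fderiv ℝ φ x (y - x)| ≤ M * ‖y - x‖ ^ 2) {x y : Space d}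
    (hx : x ∈ simplex K) (hy : y ∈ simplex K) :
    |affineInterp φ K y - affineTaylor φ x y| ≤ M * Metric.diam (simplex K) ^ 2 := by
  refine hK.abs_affineInterp_sub_le _ (fun v hv => ?_) hy
  rw [affineTaylor_apply, ← sub_sub]
  refine (hφ x v).trans ?_
  gcongr
  rw [← dist_eq_norm]
  exact Metric.dist_le_diam_of_mem (isCompact_simplex K).isBounded (subset_simplex K hv) hx

theorem abs_affineInterp_linear_sub_fderiv_le (hK : IsCell K) {M : ℝ} (hM : 0 ≤ M)
    (hφ : ∀ x y, |φ y - φ x - fderiv ℝ φ x (y - x)| ≤ M * ‖y - x‖ ^ 2)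
    {c : Space d} {r σ : ℝ} (hr : 0 < r) (hball : Metric.closedBall c r ⊆ simplex K)
    (hσ : Metric.diam (simplex K) ≤ σ * (2 * r)) {x : Space d} (hx : x ∈ simplex K)
    {e : Space d} (he : ‖e‖ ≤ 1) :
    |(affineInterp φ K).linear e - fderiv ℝ φ x e| ≤ 2 * σ * M * Metric.diam (simplex K) := by
  set D := Metric.diam (simplex K)
  have hball' : r * |(affineInterp φ K - affineTaylor φ x).linear e| ≤ M * D ^ 2 :=
    mul_abs_linear_le_of_closedBall _ hr.le
      (fun y hy => hK.abs_affineInterp_sub_affineTaylor_le hM hφ hx (hball hy)) he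
  rw [AffineMap.sub_linear, LinearMap.sub_apply, affineTaylor_linear] at hball'
  refine le_of_mul_le_mul_left ?_ hr
  calc r * |(affineInterp φ K).linear e - fderiv ℝ φ x e| ≤ M * D * D := by
        rwa [mul_assoc, ← sq]
    _ ≤ M * D * (σ * (2 * r)) := by
        gcongr
    _ = r * (2 * σ * M * D) := by ring

end IsCell

namespace Triangulation

variable (T : Triangulation Ω)

theorem affineInterp_eq_affineInterp (φ : Space d → ℝ) {K L : Finset (Space d)}
    (hK : K ∈ T.cells) (hL : L ∈ T.cells) {x : Space d} (hxK : x ∈ simplex K)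
    (hxL : x ∈ simplex L) : affineInterp φ K x = affineInterp φ L x := by
  classical
  have sum_union : ∀ M : Finset (Space d), M ⊆ K ∪ L →
      affineInterp φ M x = ∑ v ∈ K ∪ L, φ v * bary M v x := fun M hM => by
    rw [affineInterp_apply]
    refine Finset.sum_subset hM fun v _ hv => ?_
    rw [bary_eq_zero hv]
    exact mul_zero _
  rw [sum_union K Finset.subset_union_left, sum_union L Finset.subset_union_right]
  simp only [T.bary_eq_bary hK hL hxK hxL]

/-- The continuous piecewise affine interpolate of `φ`. -/
def affineInterpolate (φ : Space d → ℝ) : Space d → ℝ :=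
  T.glue fun K => affineInterp φ K

theorem affineInterpolate_eq (φ : Space d → ℝ) {K : Finset (Space d)} (hK : K ∈ T.cells)
    {x : Space d} (hx : x ∈ simplex K) : T.affineInterpolate φ x = affineInterp φ K x :=
  glue_eq (g := fun K => affineInterp φ K)
    (fun _ hK _ hL _ hxK hxL => T.affineInterp_eq_affineInterp φ hK hL hxK hxL) hK hx

theorem affineInterpolate_mem_lagrangeSpace (φ : Space d → ℝ) {l : ℕ} (hl : 1 ≤ l) :
    T.affineInterpolate φ ∈ T.lagrangeSpace l :=
  T.glue_mem_lagrangeSpace (g := fun K => affineInterp φ K)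
    (fun _ hK _ hL _ hxK hxL => T.affineInterp_eq_affineInterp φ hK hL hxK hxL)
    fun K _ => (isPolyOn_affineMap (affineInterp φ K) _).mono hl

theorem tsupport_affineInterpolate_subset (φ : Space d → ℝ) :
    tsupport (T.affineInterpolate φ) ⊆ Metric.cthickening T.meshSize (tsupport φ) := by
  refine closure_minimal (fun x hx => ?_) Metric.isClosed_cthickening
  by_cases hxc : x ∈ closure Ω
  · obtain ⟨K, hK, hxK⟩ := T.exists_mem_simplex hxc
    rw [Function.mem_support, T.affineInterpolate_eq φ hK hxK, affineInterp_apply] at hx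
    obtain ⟨v, hv, hne⟩ := Finset.exists_ne_zero_of_sum_ne_zero hx
    exact Metric.mem_cthickening_of_dist_le x v _ _ (subset_tsupport φ (left_ne_zero_of_mul hne))
      (T.dist_le_meshSize hK hxK (subset_simplex K hv))
  · exact absurd (T.glue_eq_zero _ hxc) hx

theorem exists_lipschitzOnWith_affineInterpolate (φ : Space d → ℝ) :
    ∃ L, ∀ K ∈ T.cells, LipschitzOnWith L (T.affineInterpolate φ) (simplex K) := by
  let N : Finset (Space d) → NNReal := fun K =>
    ‖LinearMap.toContinuousLinearMap (affineInterp φ K).linear‖₊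
  refine ⟨∑ K ∈ T.cells, N K, fun K hK => LipschitzOnWith.of_dist_le_mul fun x hx y hy => ?_⟩
  rw [T.affineInterpolate_eq φ hK hx, T.affineInterpolate_eq φ hK hy, dist_eq_norm,
    dist_eq_norm, ← vsub_eq_sub, ← AffineMap.linearMap_vsub, vsub_eq_sub]
  refine ((LinearMap.toContinuousLinearMap (affineInterp φ K).linear).le_opNorm (x - y)).trans ?_
  gcongr
  exact NNReal.coe_le_coe.mpr (Finset.single_le_sum (f := N) (fun _ _ => zero_le) hK)

theorem exists_lipschitzWith_affineInterpolate (hΩo : IsOpen Ω) {φ : Space d → ℝ}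
    (hs : tsupport (T.affineInterpolate φ) ⊆ Ω) :
    ∃ L, LipschitzWith L (T.affineInterpolate φ) := by
  obtain ⟨L, hL⟩ := T.exists_lipschitzOnWith_affineInterpolate φ
  refine ⟨L, lipschitzWith_of_finite_closed_cover
    (C := fun k : Option T.cells => k.elim Ωᶜ fun K => simplex (K : Finset (Space d))) ?_ ?_ ?_⟩
  · rintro (_ | K)
    · exact hΩo.isClosed_compl
    · exact (isCompact_simplex (K : Finset (Space d))).isClosed
  · refine eq_univ_of_forall fun x => mem_iUnion.mpr ?_
    by_cases hx : x ∈ Ω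
    · obtain ⟨K, hK, hxK⟩ := T.exists_mem_simplex (subset_closure hx)
      exact ⟨some ⟨K, hK⟩, hxK⟩
    · exact ⟨none, hx⟩
  · rintro (_ | K)
    · refine LipschitzOnWith.of_dist_le_mul fun x hx y hy => ?_
      rw [image_eq_zero_of_notMem_tsupport fun h => hx (hs h),
        image_eq_zero_of_notMem_tsupport fun h => hy (hs h), dist_self]
      positivity
    · exact hL K K.2

theorem memH10_affineInterpolate (hΩo : IsOpen Ω) (hΩb : Bornology.IsBounded Ω)
    {φ : Space d → ℝ} (hs : tsupport (T.affineInterpolate φ) ⊆ Ω) :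
    MemH10 Ω (T.affineInterpolate φ) := by
  obtain ⟨L, hL⟩ := T.exists_lipschitzWith_affineInterpolate hΩo hs
  exact memH10_of_lipschitzWith hΩo hΩb hL
    (Metric.isCompact_of_isClosed_isBounded (isClosed_tsupport _) (hΩb.subset hs)) hs

theorem lineDeriv_affineInterpolate (φ : Space d → ℝ) {K : Finset (Space d)} (hK : K ∈ T.cells)
    {x : Space d} (hx : x ∈ interior (simplex K)) (e : Space d) :
    lineDeriv ℝ (T.affineInterpolate φ) x e = (affineInterp φ K).linear e := by
  have hev : T.affineInterpolate φ =ᶠ[𝓝 x] affineInterp φ K := by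
    filter_upwards [isOpen_interior.mem_nhds hx] with y hy
    exact T.affineInterpolate_eq φ hK (interior_subset hy)
  rw [hev.lineDeriv_eq, lineDeriv]
  simp [affineMap_add_smul]

section Error

variable {T} {φ : Space d → ℝ} {M : ℝ}

theorem ae_abs_affineInterpolate_sub_le (hΩr : interior (closure Ω) = Ω) (hM : 0 ≤ M)
    (hφ : ∀ x y, |φ y - φ x - fderiv ℝ φ x (y - x)| ≤ M * ‖y - x‖ ^ 2) :
    ∀ᵐ x ∂volume.restrict Ω, |T.affineInterpolate φ x - φ x| ≤ M * T.meshSize ^ 2 := by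
  filter_upwards [T.ae_restrict_mem_interior_simplex hΩr] with x ⟨K, hK, hxK⟩
  have hx := interior_subset hxK
  have herr := (T.isCell hK).abs_affineInterp_sub_affineTaylor_le hM hφ hx hx
  rw [affineTaylor_apply, sub_self, map_zero, add_zero] at herr
  rw [T.affineInterpolate_eq φ hK hx]
  refine herr.trans ?_
  gcongr
  exact T.diam_le_meshSize hK

theorem ae_abs_weakPartial_affineInterpolate_sub_le (hΩo : IsOpen Ω)
    (hΩb : Bornology.IsBounded Ω) (hΩr : interior (closure Ω) = Ω) {σ : ℝ}
    (hσ : T.IsShapeRegular σ) (hM : 0 ≤ M)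
    (hφ : ∀ x y, |φ y - φ x - fderiv ℝ φ x (y - x)| ≤ M * ‖y - x‖ ^ 2)
    (hs : tsupport (T.affineInterpolate φ) ⊆ Ω) (i : Fin d) :
    ∀ᵐ x ∂volume.restrict Ω,
      |weakPartial Ω i (T.affineInterpolate φ) x - classicalPartial i φ x| ≤
        2 * |σ| * M * T.meshSize := by
  obtain ⟨L, hL⟩ := T.exists_lipschitzWith_affineInterpolate hΩo hs
  have hpartial := ((T.memH10_affineInterpolate hΩo hΩb hs).1.isWeakPartial i).ae_eq hΩo
    (isWeakPartial_lineDeriv hΩb hL i) ae_eq_rfl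
  filter_upwards [T.ae_restrict_mem_interior_simplex hΩr, hpartial] with x ⟨K, hK, hxK⟩ hx
  obtain ⟨c, r, hr, hball, hdiam⟩ := hσ K hK
  rw [hx, T.lineDeriv_affineInterpolate φ hK hxK]
  refine ((T.isCell hK).abs_affineInterp_linear_sub_fderiv_le hM hφ hr hball hdiam
    (interior_subset hxK) (by simp)).trans ?_
  have := T.diam_le_meshSize hK
  gcongr
  exact le_abs_self σ

theorem norm_sq_pair_affineInterpolate_sub_le (hΩo : IsOpen Ω) (hΩb : Bornology.IsBounded Ω)
    (hΩr : interior (closure Ω) = Ω) {σ : ℝ} (hσ : T.IsShapeRegular σ)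
    (hφ : IsTestFunction Ω φ) (hM : 0 ≤ M)
    (hφM : ∀ x y, |φ y - φ x - fderiv ℝ φ x (y - x)| ≤ M * ‖y - x‖ ^ 2)
    (hs : tsupport (T.affineInterpolate φ) ⊆ Ω) :
    ‖(T.memH10_affineInterpolate hΩo hΩb hs).toH10 - hφ.toH10‖ ^ 2 ≤
      ((M * T.meshSize ^ 2) ^ 2 + d * (2 * |σ| * M * T.meshSize) ^ 2) * volume.real Ω := by
  have integral_sq_le : ∀ {g : Space d → ℝ} {C : ℝ}, (∀ᵐ x ∂volume.restrict Ω, |g x| ≤ C) →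
      ∫ x in Ω, g x ^ 2 ≤ C ^ 2 * volume.real Ω := fun {g C} hg =>
    (le_abs_self _).trans (norm_setIntegral_le_of_norm_le_const_ae (f := fun x => g x ^ 2)
      (C := C ^ 2) hΩb.measure_lt_top
      (hg.mono fun x hx => by rw [norm_pow]; exact pow_le_pow_left₀ (abs_nonneg _) hx 2))
  refine ((T.memH10_affineInterpolate hΩo hΩb hs).1.norm_sq_pair_sub hφ).trans_le ?_
  refine (add_le_add (integral_sq_le (ae_abs_affineInterpolate_sub_le hΩr hM hφM))
    (Finset.sum_le_sum fun i _ => integral_sq_le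
      (ae_abs_weakPartial_affineInterpolate_sub_le hΩo hΩb hΩr hσ hM hφM hs i))).trans_eq ?_
  rw [Finset.sum_const, Finset.card_univ, Fintype.card_fin, nsmul_eq_mul]
  ring

end Error

/-- The finite element space `X_h` as a subspace of the Hilbert space `H¹₀(Ω)`. -/
def discretePairs (hΩo : IsOpen Ω) (l : ℕ) : Submodule ℝ (H10Space Ω) :=
  LinearMap.range ((H10Fun.toH10Space hΩo).comp
    (Submodule.inclusion (inf_le_right : T.lagrangeSubmodule l ⊓ H10Fun hΩo ≤ H10Fun hΩo)))

variable {T} in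
theorem mem_discretePairs {hΩo : IsOpen Ω} {l : ℕ} {e : H10Space Ω} :
    e ∈ T.discretePairs hΩo l ↔ ∃ v, ∃ hv : v ∈ T.discreteSpace l, hv.2.toH10 = e := by
  constructor
  · rintro ⟨⟨v, hv⟩, rfl⟩
    exact ⟨v, hv, rfl⟩
  · rintro ⟨v, hv, rfl⟩
    exact ⟨⟨v, hv⟩, rfl⟩

variable {T} in
theorem toH10_mem_discretePairs (hΩo : IsOpen Ω) {l : ℕ} {v : Space d → ℝ}
    (hv : v ∈ T.discreteSpace l) : hv.2.toH10 ∈ T.discretePairs hΩo l :=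
  mem_discretePairs.mpr ⟨v, hv, rfl⟩

theorem finiteDimensional_discretePairs (hΩo : IsOpen Ω) {l : ℕ} (hl : l ≠ 0) :
    FiniteDimensional ℝ (T.discretePairs hΩo l) := by
  have := T.finiteDimensional_lagrangeSubmodule hl
  have : FiniteDimensional ℝ ↥(T.lagrangeSubmodule l ⊓ H10Fun hΩo) :=
    Submodule.finiteDimensional_inf_left _ _
  exact LinearMap.finiteDimensional_range _

end Triangulation

section Density

variable {ι : Type*} {F : Filter ι} {T : ι → Triangulation Ω} {σ : ℝ} {l : ℕ}

theorem tendsto_infDist_toH10_discretePairs (hΩo : IsOpen Ω) (hΩb : Bornology.IsBounded Ω)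
    (hΩr : interior (closure Ω) = Ω) (hl : 1 ≤ l) (hσ : ∀ i, (T i).IsShapeRegular σ)
    (hT : Tendsto (fun i => (T i).meshSize) F (𝓝 0)) {φ : Space d → ℝ}
    (hφ : IsTestFunction Ω φ) :
    Tendsto (fun i => Metric.infDist hφ.toH10 ((T i).discretePairs hΩo l : Set (H10Space Ω)))
      F (𝓝 0) := by
  obtain ⟨M, hM, hφM⟩ := exists_norm_sub_sub_fderiv_le (hφ.1.of_le (by norm_cast)) hφ.2.1
  obtain ⟨δ, hδ, hδΩ⟩ := hφ.2.1.isCompact.exists_cthickening_subset_open hΩo hφ.2.2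
  let bound (h : ℝ) : ℝ :=
    √(((M * h ^ 2) ^ 2 + d * (2 * |σ| * M * h) ^ 2) * volume.real Ω)
  have hbound : Tendsto (fun i => bound (T i).meshSize) F (𝓝 0) := by
    have hcont : Continuous bound := by fun_prop
    have hzero : bound 0 = 0 := by simp [bound]
    exact hzero ▸ (hcont.tendsto 0).comp hT
  refine tendsto_of_tendsto_of_tendsto_of_le_of_le' tendsto_const_nhds hbound
    (.of_forall fun _ => Metric.infDist_nonneg) ?_
  filter_upwards [hT.eventually_lt_const hδ] with i hi
  have hs : tsupport ((T i).affineInterpolate φ) ⊆ Ω :=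
    ((T i).tsupport_affineInterpolate_subset φ).trans
      ((Metric.cthickening_mono hi.le _).trans hδΩ)
  refine (Metric.infDist_le_dist_of_mem (Triangulation.toH10_mem_discretePairs hΩo
    ⟨(T i).affineInterpolate_mem_lagrangeSpace φ hl,
      (T i).memH10_affineInterpolate hΩo hΩb hs⟩)).trans ?_
  rw [dist_comm, dist_eq_norm]
  exact Real.le_sqrt_of_sq_le
    (Triangulation.norm_sq_pair_affineInterpolate_sub_le hΩo hΩb hΩr (hσ i) hφ hM hφM hs)

theorem tendsto_infDist_discretePairs (hΩo : IsOpen Ω) (hΩb : Bornology.IsBounded Ω)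
    (hΩr : interior (closure Ω) = Ω) (hl : 1 ≤ l) (hσ : ∀ i, (T i).IsShapeRegular σ)
    (hT : Tendsto (fun i => (T i).meshSize) F (𝓝 0)) (e : H10Space Ω) :
    Tendsto (fun i => Metric.infDist e ((T i).discretePairs hΩo l : Set (H10Space Ω)))
      F (𝓝 0) := by
  induction e using H10Space.induction with
  | hP =>
    exact (LipschitzWith.uniformEquicontinuous _ 1 fun i =>
      Metric.lipschitz_infDist_pt _).equicontinuous.isClosed_setOfPred_tendsto continuous_const
  | h φ hφ => exact tendsto_infDist_toH10_discretePairs hΩo hΩb hΩr hl hσ hT hφ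

end Density

/-! ### The stabilised method -/

section DiscreteSolution

variable {T : Triangulation Ω} {l : ℕ} {a : Space d → Space d}
  (ha : MemLp a ⊤ (volume.restrict Ω)) {μ : Space d → ℝ} (hμ : MemLp μ ⊤ (volume.restrict Ω))
  {f u : Space d → ℝ} {τ : ℝ}

theorem isDiscreteSolution_iff_isGalerkin (hΩo : IsOpen Ω) (hΩr : interior (closure Ω) = Ω)
    (hu : IsWeakSolution Ω a μ f u) {w : Space d → ℝ} (hw : w ∈ T.discreteSpace l) :
    T.IsDiscreteSolution l a μ f (fun _ => τ) w ↔
      IsGalerkin (H10Space.bilinForm ha hμ) (H10Space.stabForm ha) (T.discretePairs hΩo l) τ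
        (H10Space.bilinForm ha hμ hu.1.toH10) hw.2.toH10 := by
  have equation_iff : ∀ v (hv : v ∈ T.discreteSpace l),
      bilin Ω a μ w v + T.stab (fun _ => τ) (advect Ω a w) (advect Ω a v) = ∫ x in Ω, f x * v x ↔
      H10Space.bilinForm ha hμ hw.2.toH10 hv.2.toH10 +
          τ * H10Space.stabForm ha hw.2.toH10 hv.2.toH10 =
        H10Space.bilinForm ha hμ hu.1.toH10 hv.2.toH10 := fun v hv => by
    rw [H10Space.bilinForm_toH10, H10Space.bilinForm_toH10, H10Space.stabForm_toH10,
      hu.2 v hv.2, T.stab_const hΩr τ (memL2_advect ha hw.2.1) (memL2_advect ha hv.2.1)]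
  constructor
  · rintro ⟨-, h⟩
    refine ⟨Triangulation.toH10_mem_discretePairs hΩo hw, fun e he => ?_⟩
    have hmem := Triangulation.mem_discretePairs.mp he
    obtain ⟨v, hv, rfl⟩ := hmem
    exact (equation_iff v hv).mp (h v hv)
  · rintro ⟨-, h⟩
    exact ⟨hw, fun v hv => (equation_iff v hv).mpr
      (h _ (Triangulation.toH10_mem_discretePairs hΩo hv))⟩

theorem exists_isGalerkin_toL2_ae_eq_discreteSolution (hΩo : IsOpen Ω)
    (hΩr : interior (closure Ω) = Ω) (hB : IsCoercive (H10Space.bilinForm ha hμ))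
    (hu : IsWeakSolution Ω a μ f u) (hl : l ≠ 0) (hτ : 0 ≤ τ) :
    ∃ e, IsGalerkin (H10Space.bilinForm ha hμ) (H10Space.stabForm ha) (T.discretePairs hΩo l) τ
        (H10Space.bilinForm ha hμ hu.1.toH10) e ∧
      H10Space.toL2 Ω e =ᵐ[volume.restrict Ω] T.discreteSolution l a μ f τ := by
  have := T.finiteDimensional_discretePairs hΩo hl
  have : CompleteSpace (T.discretePairs hΩo l) := FiniteDimensional.complete ℝ _
  obtain ⟨e, he⟩ := exists_isGalerkin (X := T.discretePairs hΩo l) hB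
    (H10Space.stabForm_self_nonneg ha) hτ (H10Space.bilinForm ha hμ hu.1.toH10)
  obtain ⟨w, hw, rfl⟩ := Triangulation.mem_discretePairs.mp he.1
  have hexists : ∃ w, T.IsDiscreteSolution l a μ f (fun _ => τ) w :=
    ⟨w, (isDiscreteSolution_iff_isGalerkin ha hμ hΩo hΩr hu hw).mpr he⟩
  have hsol : T.IsDiscreteSolution l a μ f (fun _ => τ) (T.discreteSolution l a μ f τ) := by
    rw [Triangulation.discreteSolution, dif_pos hexists]
    exact hexists.choose_spec
  exact ⟨_, (isDiscreteSolution_iff_isGalerkin ha hμ hΩo hΩr hu hsol.1).mp hsol,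
    hsol.1.2.toL2_toH10_ae_eq⟩

end DiscreteSolution

/-! ### The least-squares functional -/

theorem memL2_of_continuousOn (hΩb : Bornology.IsBounded Ω) {v : Space d → ℝ}
    (hv : ContinuousOn v (closure Ω)) : MemL2 Ω v := by
  have : IsFiniteMeasure (volume.restrict (closure Ω)) :=
    ⟨by simpa using hΩb.closure.measure_lt_top⟩
  obtain ⟨C, hC⟩ := hΩb.isCompact_closure.exists_bound_of_continuousOn hv
  have hv' : MemLp v 2 (volume.restrict (closure Ω)) :=
    MemLp.of_bound (hv.aestronglyMeasurable isClosed_closure.measurableSet) C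
      ((ae_restrict_iff' isClosed_closure.measurableSet).mpr (.of_forall hC))
  exact hv'.mono_measure (Measure.restrict_mono subset_closure le_rfl)

theorem tendsto_toLp_of_tendstoUniformlyOn {α E ι : Type*} [MeasurableSpace α]
    [NormedAddCommGroup E] {ν : Measure α} {s : Set α} (hs : MeasurableSet s) (hν : ν s < ⊤)
    {p : ENNReal} [Fact (1 ≤ p)] {F : Filter ι} {g : ι → α → E} {g₀ : α → E}
    (hg : ∀ i, MemLp (g i) p (ν.restrict s)) (hg₀ : MemLp g₀ p (ν.restrict s))
    (h : TendstoUniformlyOn g g₀ F s) :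
    Tendsto (fun i => (hg i).toLp) F (𝓝 hg₀.toLp) := by
  have : IsFiniteMeasure (ν.restrict s) := ⟨by simpa using hν⟩
  set V := (ν.restrict s).real univ ^ p.toReal⁻¹
  have : 0 ≤ V := by positivity
  refine Metric.tendsto_nhds.mpr fun ε hε => ?_
  have hε' : 0 < ε / (V + 1) := by positivity
  filter_upwards [Metric.tendstoUniformlyOn_iff.mp h _ hε'] with i hi
  rw [dist_eq_norm, ← MemLp.toLp_sub]
  have hbound : ‖((hg i).sub hg₀).toLp‖ ≤ V * (ε / (V + 1)) := by
    refine Lp.norm_le_of_ae_bound hε'.le ?_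
    filter_upwards [((hg i).sub hg₀).coeFn_toLp, ae_restrict_mem hs] with x hx hxs
    rw [hx, Pi.sub_apply, ← dist_eq_norm, dist_comm]
    exact (hi x hxs).le
  refine hbound.trans_lt ?_
  rw [mul_div_assoc', div_lt_iff₀ (by positivity)]
  linarith

theorem exists_strictConvexOn_lsFunctional (hΩo : IsOpen Ω) (hΩb : Bornology.IsBounded Ω)
    (hΩr : interior (closure Ω) = Ω) {a : Space d → Space d}
    (ha : MemLp a ⊤ (volume.restrict Ω)) {μ : Space d → ℝ} (hμ : MemLp μ ⊤ (volume.restrict Ω))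
    (hB : IsCoercive (H10Space.bilinForm ha hμ)) {f u : Space d → ℝ}
    (hu : IsWeakSolution Ω a μ f u) (huc : ContinuousOn u (closure Ω))
    (hadv : ¬ ∀ᵐ x ∂volume.restrict Ω, advect Ω a u x = 0) {ι : Type*} {F : Filter ι}
    {T : ι → Triangulation Ω} {σ : ℝ} (hσ : ∀ i, (T i).IsShapeRegular σ)
    (hT : Tendsto (fun i => (T i).meshSize) F (𝓝 0)) {l : ℕ} (hl : 1 ≤ l) :
    ∃ δ > 0, ∀ᶠ i in F, ContinuousOn ((T i).lsFunctional l a μ f u) (Icc 0 δ) ∧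
      StrictConvexOn ℝ (Icc 0 δ) ((T i).lsFunctional l a μ f u) := by
  have hl₀ : l ≠ 0 := Nat.one_le_iff_ne_zero.mp hl
  have : ∀ i, CompleteSpace ((T i).discretePairs hΩo l) := fun i =>
    have := (T i).finiteDimensional_discretePairs hΩo hl₀
    FiniteDimensional.complete ℝ _
  have hinterp : ∀ i, MemL2 Ω ((T i).interpolate l u) := fun i =>
    memL2_of_continuousOn hΩb ((T i).isInterpolant_interpolate hl₀ u).1.1
  have hlim : Tendsto (fun i => MemLp.toLp _ (hinterp i)) F (𝓝 (H10Space.toL2 Ω hu.1.toH10)) :=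
    tendsto_toLp_of_tendstoUniformlyOn hΩo.measurableSet hΩb.measure_lt_top hinterp hu.1.1.1
      ((tendstoUniformlyOn_interpolate hΩb hl₀ huc hT).mono subset_closure)
  choose! w hw hw_ae using fun i τ (hτ : τ ∈ Ici (0 : ℝ)) =>
    exists_isGalerkin_toL2_ae_eq_discreteSolution (T := T i) ha hμ hΩo hΩr hB hu hl₀ hτ
  obtain ⟨δ, hδ, H⟩ := exists_strictConvexOn_of_isGalerkin hB (H10Space.stabForm_self_nonneg ha)
    (H10Space.toL2 Ω) (H10Space.toL2_injective hΩo) (H10Space.stabForm_toH10_ne_zero ha hu.1 hadv)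
    (tendsto_infDist_discretePairs hΩo hΩb hΩr hl hσ hT) hlim hw
  refine ⟨δ, hδ, H.mono fun i ⟨hcont, hconv⟩ => ?_⟩
  have heq : EqOn (fun τ => (1 / 2 : ℝ) *
      ‖H10Space.toL2 Ω (w i τ) - MemLp.toLp _ (hinterp i)‖ ^ 2)
      ((T i).lsFunctional l a μ f u) (Icc 0 δ) := fun τ hτ =>
    congrArg ((1 / 2 : ℝ) * ·) (norm_sq_Lp_real_eq_integral
      ((Lp.coeFn_sub _ _).trans ((hw_ae i τ hτ.1).sub (MemLp.coeFn_toLp (hinterp i)))))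
  exact ⟨hcont.congr heq.symm, hconv.congr heq⟩

/-! ### Activity of the advection -/

theorem ae_eq_zero_of_advect_ae_eq_zero (hΩb : Bornology.IsBounded Ω) {a : Space d → Space d}
    (ha : MemLp a ⊤ (volume.restrict Ω)) {c : Space d} (hc : c ≠ 0)
    (hac : ∀ᵐ x ∂volume.restrict Ω, a x = c) {u : Space d → ℝ} (hu : MemH10 Ω u)
    (hadv : ∀ᵐ x ∂volume.restrict Ω, advect Ω a u x = 0) : u =ᵐ[volume.restrict Ω] 0 := by
  obtain ⟨R, hR⟩ := hΩb.exists_norm_le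
  have hadv' : innerLp ha (H10Space.grad Ω hu.toH10) = 0 :=
    Lp.ext (((hu.innerLp_grad_toH10_ae_eq ha).trans hadv).trans (Lp.coeFn_zero _ _ _).symm)
  have hpoincare := H10Space.norm_sq_mul_norm_toL2_sq_le hR ha hac hu.toH10
  rw [hadv', norm_zero, zero_pow two_ne_zero, mul_zero, ← mul_pow] at hpoincare
  have hprod : ‖c‖ * ‖H10Space.toL2 Ω hu.toH10‖ = 0 :=
    pow_eq_zero_iff two_ne_zero |>.mp (hpoincare.antisymm (sq_nonneg _))
  have hu₀ : H10Space.toL2 Ω hu.toH10 = 0 :=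
    norm_eq_zero.mp ((mul_eq_zero_iff_left (norm_ne_zero_iff.mpr hc)).mp hprod)
  exact hu.toL2_toH10_ae_eq.symm.trans (hu₀ ▸ Lp.coeFn_zero _ _ _)

theorem weakPartial_ae_eq_zero (hΩo : IsOpen Ω) {v : Space d → ℝ} (hv : MemH1 Ω v)
    (hv₀ : v =ᵐ[volume.restrict Ω] 0) (i : Fin d) : weakPartial Ω i v =ᵐ[volume.restrict Ω] 0 :=
  (hv.isWeakPartial i).ae_eq hΩo (v' := 0) ⟨MemLp.zero, fun φ _ => by simp⟩ hv₀

theorem weakLaplacian_ae_eq_zero (hΩo : IsOpen Ω) {v : Space d → ℝ} (hv : MemH2 Ω v)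
    (hv₀ : v =ᵐ[volume.restrict Ω] 0) : ∀ᵐ x ∂volume.restrict Ω, weakLaplacian Ω v x = 0 := by
  have hsecond : ∀ i, weakPartial Ω i (weakPartial Ω i v) =ᵐ[volume.restrict Ω] 0 := fun i =>
    weakPartial_ae_eq_zero hΩo (hv.2 i) (weakPartial_ae_eq_zero hΩo hv.1 hv₀ i) i
  filter_upwards [eventually_all.mpr hsecond] with x hx
  exact Finset.sum_eq_zero fun i _ => hx i

theorem not_ae_advect_eq_zero (hΩo : IsOpen Ω) (hΩb : Bornology.IsBounded Ω)
    {a : Space d → Space d} (ha : MemLp a ⊤ (volume.restrict Ω)) {c : Space d} (hc : c ≠ 0)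
    (hac : ∀ᵐ x ∂volume.restrict Ω, a x = c) {u : Space d → ℝ} (hu : MemH10 Ω u)
    (huH2 : MemH2 Ω u) (hΔ : ¬ ∀ᵐ x ∂volume.restrict Ω, weakLaplacian Ω u x = 0) :
    ¬ ∀ᵐ x ∂volume.restrict Ω, advect Ω a u x = 0 := fun hadv =>
  hΔ (weakLaplacian_ae_eq_zero hΩo huH2 (ae_eq_zero_of_advect_ae_eq_zero hΩb ha hc hac hu hadv))

theorem existsUnique_isMinOn_of_strictConvexOn {E : Type*} [TopologicalSpace E] [AddCommMonoid E]
    [Module ℝ E] {s : Set E} {J : E → ℝ} (hs : IsCompact s) (hne : s.Nonempty)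
    (hcont : ContinuousOn J s) (hconv : StrictConvexOn ℝ s J) : ∃! x, x ∈ s ∧ IsMinOn J s x := by
  obtain ⟨x, hx, hmin⟩ := hs.exists_isMinOn hne hcont
  exact ⟨x, ⟨hx, hmin⟩, fun y hy => hconv.eq_of_isMinOn hy.2 hmin hy.1 hx⟩

theorem exists_forall_lt_of_eventually_comap {ι : Type*} {h : ι → ℝ} (hh : ∀ i, 0 ≤ h i)
    {P : ι → Prop} (hP : ∀ᶠ i in comap h (𝓝 0), P i) : ∃ h₀ > 0, ∀ i, h i < h₀ → P i := by
  obtain ⟨h₀, hh₀, H⟩ := Metric.eventually_nhds_iff.mp (eventually_comap.mp hP)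
  exact ⟨h₀, hh₀, fun i hi => H (by rwa [Real.dist_0_eq_abs, abs_of_nonneg (hh i)]) i rfl⟩

end AdvDiff

end

theorem mainTheorem1_general
    {d : ℕ} {Ω : Set (AdvDiff.Space d)} (hΩo : IsOpen Ω) (hΩb : Bornology.IsBounded Ω)
    (hΩr : interior (closure Ω) = Ω)
    {a : AdvDiff.Space d → AdvDiff.Space d} (ha : MemLp a ⊤ (volume.restrict Ω))
    (hdiv : AdvDiff.IsDivFree Ω a)
    {μ : AdvDiff.Space d → ℝ} (hμ : MemLp μ ⊤ (volume.restrict Ω))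
    {μ₀ : ℝ} (hμ₀ : 0 < μ₀) (hμ_ge : ∀ᵐ x ∂volume.restrict Ω, μ₀ ≤ μ x)
    {f u : AdvDiff.Space d → ℝ} (hu : AdvDiff.IsWeakSolution Ω a μ f u)
    (huc : ContinuousOn u (closure Ω))
    (hadv : ¬ ∀ᵐ x ∂volume.restrict Ω, AdvDiff.advect Ω a u x = 0)
    {ι : Type*} {T : ι → AdvDiff.Triangulation Ω} {σ : ℝ} (hT : ∀ i, (T i).IsShapeRegular σ)
    {l : ℕ} (hl : 1 ≤ l) (αmax : ℝ) :
    ∃ h₀ : ℝ, 0 < h₀ ∧ ∀ αmin : ℝ, 0 ≤ αmin → αmin ≤ αmax → ∀ i, (T i).meshSize < h₀ →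
      StrictConvexOn ℝ
        (Icc (αmin * (T i).meshSize ^ 2) (αmax * (T i).meshSize ^ 2))
        ((T i).lsFunctional l a μ f u) ∧
      ∃! τ : ℝ, τ ∈ Icc (αmin * (T i).meshSize ^ 2) (αmax * (T i).meshSize ^ 2) ∧
        IsMinOn ((T i).lsFunctional l a μ f u)
          (Icc (αmin * (T i).meshSize ^ 2) (αmax * (T i).meshSize ^ 2)) τ := by
  have hd : 1 ≤ d := by
    by_contra! hd
    obtain rfl : d = 0 := Nat.lt_one_iff.mp hd
    refine hadv (.of_forall fun x => ?_)
    rw [AdvDiff.advect, Subsingleton.elim (a x) 0, inner_zero_left]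
  have hmesh : Filter.Tendsto (fun i => (T i).meshSize)
    (Filter.comap (fun i => (T i).meshSize) (nhds 0)) (nhds 0) := Filter.tendsto_comap
  obtain ⟨δ, hδ, hconv⟩ := AdvDiff.exists_strictConvexOn_lsFunctional hΩo hΩb hΩr ha hμ
    (AdvDiff.H10Space.isCoercive_bilinForm ha hμ hd hΩb hdiv hμ₀ hμ_ge) hu huc hadv hT hmesh hl
  have hsmall := ((hmesh.pow 2).const_mul αmax).eventually_lt_const (by simpa using hδ)
  obtain ⟨h₀, hh₀, H⟩ := AdvDiff.exists_forall_lt_of_eventually_comap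
    (fun i => (T i).meshSize_nonneg) (hconv.and hsmall)
  refine ⟨h₀, hh₀, fun αmin hαmin hα i hi => ?_⟩
  obtain ⟨⟨hcont, hconv⟩, hlt⟩ := H i hi
  have hsub : Icc (αmin * (T i).meshSize ^ 2) (αmax * (T i).meshSize ^ 2) ⊆ Icc 0 δ :=
    Icc_subset_Icc (by positivity) hlt.le
  have hstrict := hconv.subset hsub (convex_Icc _ _)
  exact ⟨hstrict, AdvDiff.existsUnique_isMinOn_of_strictConvexOn isCompact_Icc
    (nonempty_Icc.mpr (by gcongr)) (hcont.mono hsub) hstrict⟩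

theorem mainTheorem1
    (d : ℕ) (hd₁ : 1 ≤ d) (hd₃ : d ≤ 3)
    -- the polytopal domain
    (Ω : Set (AdvDiff.Space d)) (hΩo : IsOpen Ω) (hΩc : IsConnected Ω)
    (hΩb : Bornology.IsBounded Ω) (hΩr : interior (closure Ω) = Ω)
    -- the data
    (a : AdvDiff.Space d → AdvDiff.Space d) (ha : MemLp a ⊤ (volume.restrict Ω))
    (hdiv : AdvDiff.IsDivFree Ω a)
    (μ : AdvDiff.Space d → ℝ) (hμ : MemLp μ ⊤ (volume.restrict Ω))
    (μ₀ : ℝ) (hμ₀ : 0 < μ₀) (hμ_ge : ∀ᵐ x ∂(volume.restrict Ω), μ₀ ≤ μ x)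
    (f : AdvDiff.Space d → ℝ) (hf : AdvDiff.MemL2 Ω f)
    -- the exact solution, in its continuous representative, so that it has values at the nodes
    (u : AdvDiff.Space d → ℝ) (hu : AdvDiff.IsWeakSolution Ω a μ f u)
    (huc : ContinuousOn u (closure Ω))
    (huH2 : AdvDiff.MemH2 Ω u)
    (hΔ : ¬ ∀ᵐ x ∂(volume.restrict Ω), AdvDiff.weakLaplacian Ω u x = 0)
    -- the advection is active: a nonzero constant, or not tangent to the level sets of `u`
    (hadv : (∃ c : AdvDiff.Space d, c ≠ 0 ∧ ∀ᵐ x ∂(volume.restrict Ω), a x = c) ∨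
      ¬ ∀ᵐ x ∂(volume.restrict Ω), AdvDiff.advect Ω a u x = 0)
    (hadj : AdvDiff.AdjointH2Regularising Ω a μ)
    -- the regular family of triangulations and the polynomial degree
    {ι : Type*} (T : ι → AdvDiff.Triangulation Ω)
    (σ : ℝ) (hT : ∀ i, (T i).IsShapeRegular σ)
    (l : ℕ) (hl : 1 ≤ l) :
    ∃ α₀ : ℝ, 0 < α₀ ∧ ∀ αmax : ℝ, α₀ < αmax → ∃ h₀ : ℝ, 0 < h₀ ∧
      ∀ αmin : ℝ, α₀ ≤ αmin → αmin < αmax → ∀ i, (T i).meshSize < h₀ →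
        StrictConvexOn ℝ
          (Icc (αmin * (T i).meshSize ^ 2) (αmax * (T i).meshSize ^ 2))
          ((T i).lsFunctional l a μ f u) ∧
        ∃! τ : ℝ, τ ∈ Icc (αmin * (T i).meshSize ^ 2) (αmax * (T i).meshSize ^ 2) ∧
          IsMinOn ((T i).lsFunctional l a μ f u)
            (Icc (αmin * (T i).meshSize ^ 2) (αmax * (T i).meshSize ^ 2)) τ := by
  have hadv' : ¬ ∀ᵐ x ∂volume.restrict Ω, AdvDiff.advect Ω a u x = 0 :=
    hadv.elim
      (fun ⟨_, hc, hac⟩ => AdvDiff.not_ae_advect_eq_zero hΩo hΩb ha hc hac hu.1 huH2 hΔ) id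
  refine ⟨1, one_pos, fun αmax _ => ?_⟩
  obtain ⟨h₀, hh₀, H⟩ :=
    mainTheorem1_general hΩo hΩb hΩr ha hdiv hμ hμ₀ hμ_ge hu huc hadv' hT hl αmax
  exact ⟨h₀, hh₀, fun αmin h₁ h₂ => H αmin (zero_le_one.trans h₁) h₂.le⟩
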